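/- Let $S^1\subset\mathbb R^2$ be the unit circle with arc length measure $\sigma$, and let $P=\{(x,y)\in\mathbb R^2: y=\tfrac12 x^2\}$ carry the measure $\sigma_P$ that is the push-forward of Lebesgue measure $dx$ on $\mathbb R$ under $x\mapsto(x,\tfrac12x^2)$. With the Fourier transform $\widehat F(\xi)=\int e^{-i\xi\cdot x}F(x)\,dx$ (understood, for the measures below, as $\widehat{f\sigma}(\xi)=\int_{S^1} e^{-i\xi\cdot z}f(z)\,d\sigma(z)$, and for $f\sigma_P$ in the sense of tempered distributions), define the sharp constants $$\mathcal R:=\sup\{\|\widehat{f\sigma}\|_{L^6(\mathbb R^2)}: f\in L^2(S^1,\sigma;\mathbb C),\ \|f\|_{L^2(S^1,\sigma)}=1\},$$ $$\mathcal R_P:=\sup\Big\{\frac{\|\widehat{f\sigma_P}\|_{L^6(\mathbb R^2)}}{\|f\|_{L^2(P,\sigma_P)}}: f\in L^2(P,\sigma_P;\mathbb C),\ f\ne0\Big\},$$ where the $L^6$ norm of a distribution not given by a function in $L^6$ is $+\infty$. Then $\mathcal R<\infty$ and $$\mathcal R>(5/2)^{1/6}\,\mathcal R_P .$$ (In particular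 $\mathcal R_P<\infty$.) -/

import Mathlib

namespace TomasStein

noncomputable section

open MeasureTheory Complex
open scoped ENNReal

/-- The Euclidean plane `ℝ²`. -/
abbrev Plane : Type := EuclideanSpace ℝ (Fin 2)

/-- The character `e^{-i ξ·x}`, the kernel of the Fourier transform
`F̂(ξ) = ∫ e^{-i ξ·x} F(x) dx` (no `2π` in the exponent, no prefactor). -/
def kernel (ξ x : Plane) : ℂ := exp (-I * ((inner ℝ ξ x : ℝ) : ℂ))

/-! ### The circle -/

/-- The unit circle `S¹ ⊆ ℝ²`. -/
abbrev Circle1 : Type := Metric.sphere (0 : Plane) 1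

/-- Surface measure (arc length, total mass `2π`) on the unit circle. -/
def circleMeasure : Measure Circle1 := (volume : Measure Plane).toSphere

/-- The Fourier transform of the measure `f σ`. The integral converges for all `f ∈ L²(S¹, σ)`,
since `σ` is finite. -/
def circleFourier (f : Circle1 → ℂ) (ξ : Plane) : ℂ :=
  ∫ z : Circle1, kernel ξ z * f z ∂circleMeasure

/-- The optimal constant of the inequality `‖(fσ)^‖_{L⁶(ℝ²)} ≤ R ‖f‖_{L²(S¹, σ)}`. -/
def circleConst : ℝ≥0∞ :=
  ⨆ (f : Circle1 → ℂ) (_ : MemLp f 2 circleMeasure) (_ : eLpNorm f 2 circleMeasure = 1),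
    eLpNorm (circleFourier f) 6 (volume : Measure Plane)

/-! ### The parabola -/

/-- The parabola `P = {(x, y) : y = x² / 2}`. -/
def parabola : Set Plane := {p | p 1 = (p 0) ^ 2 / 2}

/-- The parametrization `y ↦ (y, y² / 2)` of the parabola. -/
def parabolaParam (y : ℝ) : parabola := ⟨!₂[y, y ^ 2 / 2], by simp [parabola]⟩

/-- The canonical measure `σ_P` on the parabola: `dy` in the parametrization `y ↦ (y, y² / 2)`. -/
def parabolaMeasure : Measure parabola := (volume : Measure ℝ).map parabolaParam

/-- The function `u` on `ℝ²` is the Fourier transform of `f σ_P` in the sense of tempered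
distributions: `⟨u, φ⟩ = ⟨f σ_P, φ̂⟩` for all Schwartz functions `φ`. (A function `f ∈ L²(P, σ_P)`
need not be integrable, so the transform cannot be taken pointwise.) -/
def IsParabolaFourier (f : parabola → ℂ) (u : Plane → ℂ) : Prop :=
  ∀ φ : SchwartzMap Plane ℂ,
    ∫ ξ : Plane, u ξ * φ ξ =
      ∫ z : parabola, f z * (∫ ξ : Plane, kernel z ξ * φ ξ) ∂parabolaMeasure

/-- `‖(f σ_P)^‖_{L⁶(ℝ²)}`: the `L⁶` norm of the (a.e. unique) function in `L⁶(ℝ²)` that is the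
Fourier transform of `f σ_P`, and `∞` if there is no such function. -/
def parabolaFourierNorm (f : parabola → ℂ) : ℝ≥0∞ :=
  ⨅ (u : Plane → ℂ) (_ : MemLp u 6 (volume : Measure Plane)) (_ : IsParabolaFourier f u),
    eLpNorm u 6 (volume : Measure Plane)

/-- The optimal constant of the inequality
`‖(f σ_P)^‖_{L⁶(ℝ²)} ≤ R_P ‖f‖_{L²(P, σ_P)}`. -/
def parabolaConst : ℝ≥0∞ :=
  ⨆ (f : parabola → ℂ) (_ : MemLp f 2 parabolaMeasure) (_ : eLpNorm f 2 parabolaMeasure ≠ 0),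
    parabolaFourierNorm f / eLpNorm f 2 parabolaMeasure

end

end TomasStein

namespace TomasStein

open MeasureTheory Complex Filter
open scoped ENNReal FourierTransform Topology Pointwise

/-! Both extension problems live at the exponent 6, where the cube of the transform of `f σ` is the
transform of the threefold convolution of `f σ`. By Plancherel and Cauchy–Schwarz, if the threefold
convolution of `σ` has density at most `C`, then `‖(f σ)^‖₆ ≤ (4π² C)^{1/6} ‖f‖₂`.

On a graph over an interval whose slope increases at least at unit rate, `C = 2π/√3` is admissible
(`lintegral_graph_convolution_le`): on the plane `x + y + z = s`, take polar coordinates about the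
barycentre. Along each ray the height sum has derivative at least `2r`, which absorbs the polar
factor `r`. For the parabola this gives `R_P⁶ ≤ 8π³/√3` on integrable `f`, hence on all of `L²` by
density.

Finiteness for the circle uses the same bound: three arcs of half-angle `π/3`, each a rotated piece
of a convex graph.

For the strict inequality, test `R` with the normalized constant. From `cos t ≥ 1 - t²/2`, its
transform has modulus at least `√(2π) (1 - |ξ|²/4)`, so `R⁶ ≥ (2π)⁴ · 2/7`. This exceeds `(5/2) ·
8π³/√3`, so the exact value of neither constant is needed. -/

/-! ### The character and Gaussian integrals. -/

lemma norm_kernel (ξ x : Plane) : ‖kernel ξ x‖ = 1 := by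
  rw [kernel, Complex.norm_exp]
  simp

lemma continuous_kernel : Continuous fun p : Plane × Plane => kernel p.1 p.2 := by
  unfold kernel
  fun_prop

lemma measurable_kernel_comp {Y : Type*} [MeasurableSpace Y] {a b : Y → Plane}
    (ha : Measurable a) (hb : Measurable b) : Measurable fun y => kernel (a y) (b y) := by
  unfold kernel
  exact Complex.measurable_exp.comp
    ((Complex.measurable_ofReal.comp (ha.inner hb)).const_mul (-I))

lemma kernel_add (ξ x y : Plane) : kernel ξ (x + y) = kernel ξ x * kernel ξ y := by
  rw [kernel, kernel, kernel, ← Complex.exp_add, inner_add_right]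
  push_cast
  ring_nf

lemma kernel_sub (ξ x y : Plane) :
    kernel ξ (x - y) = kernel ξ x * (starRingEnd ℂ) (kernel ξ y) := by
  rw [kernel, kernel, kernel, ← Complex.exp_conj, ← Complex.exp_add, inner_sub_right]
  simp only [map_mul, map_neg, conj_I, conj_ofReal]
  push_cast
  ring_nf

lemma kernel_comm (ξ x : Plane) : kernel ξ x = kernel x ξ := by
  rw [kernel, kernel, real_inner_comm]

/-- The Fourier transform of a Gaussian on the plane. -/
lemma integral_gaussian_mul_kernel {ε : ℝ} (hε : 0 < ε) (v : Plane) :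
    ∫ ξ : Plane, (Real.exp (-ε * ‖ξ‖ ^ 2) : ℂ) * kernel ξ v =
      ((Real.pi / ε * Real.exp (-(1 / (4 * ε)) * ‖v‖ ^ 2) : ℝ) : ℂ) := by
  have h := GaussianFourier.integral_cexp_neg_mul_sq_norm_add (b := (ε : ℂ)) (V := Plane)
    (by simpa using hε) (-I) v
  have h2 : (Module.finrank ℝ Plane : ℂ) / 2 = 1 := by simp
  rw [h2, Complex.cpow_one] at h
  calc _ = ∫ ξ : Plane, cexp (-ε * ‖ξ‖ ^ 2 + -I * (inner ℝ v ξ : ℝ)) := by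
        refine integral_congr_ae (.of_forall fun ξ => ?_)
        simp only [kernel]
        rw [Complex.ofReal_exp, ← Complex.exp_add, real_inner_comm]
        push_cast
        rfl
    _ = _ := by
        rw [h]
        push_cast
        congr 2
        rw [neg_sq, I_sq]
        field_simp

lemma integrable_gaussian {ε : ℝ} (hε : 0 < ε) :
    Integrable fun v : Plane => Real.exp (-ε * ‖v‖ ^ 2) := by
  have h := GaussianFourier.integral_rexp_neg_mul_sq_norm (V := Plane) hε
  by_contra hn
  rw [integral_undef hn] at h
  have : 0 < (Real.pi / ε) ^ ((Module.finrank ℝ Plane : ℝ) / 2) := by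
    have := Real.pi_pos
    positivity
  linarith

/-- The mass does not depend on `ε`; this keeps the damped `L²` bound uniform as the damping is
removed. The value `4π² = (2π)²` is the Plancherel factor of the chosen normalization. -/
lemma lintegral_gaussian {ε : ℝ} (hε : 0 < ε) :
    ∫⁻ v : Plane, ENNReal.ofReal (Real.pi / ε * Real.exp (-(1 / (4 * ε)) * ‖v‖ ^ 2)) =
      ENNReal.ofReal (4 * Real.pi ^ 2) := by
  have hb : 0 < 1 / (4 * ε) := by positivity
  have h := GaussianFourier.integral_rexp_neg_mul_sq_norm (V := Plane) hb
  have hi := integrable_gaussian hb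
  rw [← ofReal_integral_eq_lintegral_ofReal (hi.const_mul _)
    (.of_forall fun v => by have := Real.pi_pos; positivity), integral_const_mul, h]
  have h2 : (Module.finrank ℝ Plane : ℝ) / 2 = 1 := by simp
  rw [h2, Real.rpow_one]
  congr 1
  field_simp

lemma ennreal_two_mul_le_add_sq (a b : ℝ≥0∞) : 2 * (a * b) ≤ a ^ 2 + b ^ 2 := by
  by_cases ha : a = ⊤
  · simp [ha]
  by_cases hb : b = ⊤
  · simp [hb]
  lift a to NNReal using ha
  lift b to NNReal using hb
  have := two_mul_le_add_sq a b
  rw [mul_assoc] at this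
  exact_mod_cast this

/-! ### Plancherel-type bounds from bounded density. -/

section Extension

variable {X : Type*} [MeasurableSpace X]

/-- The Fourier transform of the image under `Φ` of the measure `g μ`. -/
noncomputable def extension (μ : Measure X) (Φ : X → Plane) (g : X → ℂ) (ξ : Plane) : ℂ :=
  ∫ x, kernel ξ (Φ x) * g x ∂μ

lemma integrable_kernel_mul {μ : Measure X} {Φ : X → Plane} (hΦ : Measurable Φ) {g : X → ℂ}
    (hg : Integrable g μ) (ξ : Plane) : Integrable (fun x => kernel ξ (Φ x) * g x) μ := by
  refine hg.mono ((measurable_kernel_comp measurable_const hΦ).aestronglyMeasurable.mul hg.1) ?_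
  exact .of_forall fun x => by simp [norm_kernel]

lemma continuous_extension {μ : Measure X} {Φ : X → Plane} (hΦ : Measurable Φ) {g : X → ℂ}
    (hg : Integrable g μ) : Continuous (extension μ Φ g) := by
  refine continuous_of_dominated (fun ξ => (integrable_kernel_mul hΦ hg ξ).1)
    (fun ξ => .of_forall fun x => ?_) hg.norm (.of_forall fun x => ?_)
  · simp [norm_kernel]
  · exact (continuous_kernel.comp (continuous_id.prodMk continuous_const)).mul continuous_const

lemma norm_extension_le {μ : Measure X} {Φ : X → Plane} {g : X → ℂ} (ξ : Plane) :
    ‖extension μ Φ g ξ‖ ≤ ∫ x, ‖g x‖ ∂μ := by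
  refine (norm_integral_le_integral_norm _).trans_eq ?_
  simp [norm_kernel]

lemma extension_mul_conj {μ : Measure X} [SFinite μ] {Φ : X → Plane} {g : X → ℂ} (ξ : Plane) :
    ((‖extension μ Φ g ξ‖ ^ 2 : ℝ) : ℂ) =
      ∫ p : X × X, kernel ξ (Φ p.1 - Φ p.2) * (g p.1 * (starRingEnd ℂ) (g p.2)) ∂μ.prod μ := by
  rw [← Complex.normSq_eq_norm_sq, Complex.normSq_eq_conj_mul_self, mul_comm]
  unfold extension
  rw [← integral_conj, ← integral_prod_mul]
  refine integral_congr_ae (.of_forall fun p => ?_)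
  simp only [kernel_sub, map_mul]
  ring

/-- A damped `L²` bound for Fourier transforms of measures with bounded density. -/
lemma lintegral_extension_gaussian_le {μ : Measure X} [SFinite μ] {Φ : X → Plane}
    (hΦ : Measurable Φ) {C : ℝ≥0∞}
    (hC : ∀ h : Plane → ℝ≥0∞, Measurable h → ∫⁻ x, h (Φ x) ∂μ ≤ C * ∫⁻ v, h v)
    {g : X → ℂ} (hg : Integrable g μ) {ε : ℝ} (hε : 0 < ε) :
    ∫⁻ ξ, ENNReal.ofReal (Real.exp (-ε * ‖ξ‖ ^ 2)) * ‖extension μ Φ g ξ‖ₑ ^ 2 ≤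
      ENNReal.ofReal (4 * Real.pi ^ 2) * C * ∫⁻ x, ‖g x‖ₑ ^ 2 ∂μ := by
  set w : Plane → ℝ := fun ξ => Real.exp (-ε * ‖ξ‖ ^ 2) with hw
  set G : Plane → ℝ := fun v => Real.pi / ε * Real.exp (-(1 / (4 * ε)) * ‖v‖ ^ 2) with hG
  have hG0 : ∀ v, 0 ≤ G v := fun v => by have := Real.pi_pos; positivity
  have hGm : Measurable G := by
    have : Continuous G := by fun_prop
    exact this.measurable
  have hGneg : ∀ v, G (-v) = G v := fun v => by simp [hG]
  have hw0 : ∀ ξ, 0 ≤ w ξ := fun ξ => (Real.exp_pos _).le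
  have hwi : Integrable w := integrable_gaussian hε
  have hgg : Integrable (fun p : X × X => g p.1 * (starRingEnd ℂ) (g p.2)) (μ.prod μ) := by
    have h' : Integrable (fun x => (starRingEnd ℂ) (g x)) μ :=
      hg.mono (Complex.continuous_conj.comp_aestronglyMeasurable hg.1)
        (.of_forall fun x => by simp)
    exact hg.mul_prod h'
  have hdiff : Measurable fun p : X × X => Φ p.1 - Φ p.2 :=
    (hΦ.comp measurable_fst).sub (hΦ.comp measurable_snd)
  have hint : Integrable (fun q : Plane × (X × X) => ((w q.1 : ℝ) : ℂ) *
      (kernel q.1 (Φ q.2.1 - Φ q.2.2) * (g q.2.1 * (starRingEnd ℂ) (g q.2.2))))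
      (volume.prod (μ.prod μ)) := by
    have h1 : Integrable (fun q : Plane × (X × X) => ((w q.1 : ℝ) : ℂ) *
        (g q.2.1 * (starRingEnd ℂ) (g q.2.2))) (volume.prod (μ.prod μ)) :=
      (hwi.ofReal (𝕜 := ℂ)).mul_prod hgg
    have hk : Measurable fun q : Plane × (X × X) => kernel q.1 (Φ q.2.1 - Φ q.2.2) :=
      measurable_kernel_comp measurable_fst (hdiff.comp measurable_snd)
    refine h1.mono (AEStronglyMeasurable.congr (hk.aestronglyMeasurable.mul h1.1)
      (.of_forall fun q => ?_)) (.of_forall fun q => ?_)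
    · simp only [Pi.mul_apply]
      ring
    · rw [norm_mul, norm_mul, norm_kernel, one_mul, ← norm_mul]
  have hUc := continuous_extension hΦ hg
  have hUi : Integrable fun ξ => w ξ * ‖extension μ Φ g ξ‖ ^ 2 := by
    refine hwi.mul_bdd (c := (∫ x, ‖g x‖ ∂μ) ^ 2) (by fun_prop) (.of_forall fun ξ => ?_)
    rw [norm_pow, norm_norm]
    gcongr
    exact norm_extension_le ξ
  -- Expanding the square as a double integral and integrating out `ξ` replaces the weight by its
  -- Fourier transform `G`. As `G` is nonnegative, absolute values may be taken afterwards without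
  -- loss in the kernel.
  have key : ((∫ ξ, w ξ * ‖extension μ Φ g ξ‖ ^ 2 : ℝ) : ℂ) =
      ∫ p : X × X, (G (Φ p.1 - Φ p.2) : ℂ) * (g p.1 * (starRingEnd ℂ) (g p.2)) ∂μ.prod μ := by
    rw [← integral_complex_ofReal]
    calc _ = ∫ ξ, ∫ p : X × X, (w ξ : ℂ) * (kernel ξ (Φ p.1 - Φ p.2) *
          (g p.1 * (starRingEnd ℂ) (g p.2))) ∂μ.prod μ := by
          refine integral_congr_ae (.of_forall fun ξ => ?_)
          simp only
          rw [integral_const_mul, ← extension_mul_conj]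
          push_cast
          rfl
      _ = _ := by
          rw [integral_integral_swap hint]
          refine integral_congr_ae (.of_forall fun p => ?_)
          simp only
          rw [← integral_gaussian_mul_kernel hε, ← integral_mul_const]
          refine integral_congr_ae (.of_forall fun ξ => ?_)
          simp only [hw]
          ring
  calc _ = ENNReal.ofReal (∫ ξ, w ξ * ‖extension μ Φ g ξ‖ ^ 2) := by
        rw [ofReal_integral_eq_lintegral_ofReal hUi
          (.of_forall fun ξ => mul_nonneg (hw0 ξ) (by positivity))]
        refine lintegral_congr fun ξ => ?_
        rw [ENNReal.ofReal_mul (hw0 ξ), ENNReal.ofReal_pow (norm_nonneg _), ofReal_norm]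
    _ = ‖∫ p : X × X, (G (Φ p.1 - Φ p.2) : ℂ) * (g p.1 * (starRingEnd ℂ) (g p.2)) ∂μ.prod μ‖ₑ := by
        rw [← key, ← ofReal_norm, Complex.norm_real, Real.norm_of_nonneg]
        exact integral_nonneg fun ξ => mul_nonneg (hw0 ξ) (by positivity)
    _ ≤ ∫⁻ p : X × X, ENNReal.ofReal (G (Φ p.1 - Φ p.2)) * (‖g p.1‖ₑ * ‖g p.2‖ₑ) ∂μ.prod μ := by
        refine (enorm_integral_le_lintegral_enorm _).trans_eq (lintegral_congr fun p => ?_)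
        rw [enorm_mul, enorm_mul]
        congr 1
        · rw [← ofReal_norm, Complex.norm_real, Real.norm_of_nonneg (hG0 _)]
        · congr 1
          rw [← ofReal_norm, RCLike.norm_conj, ofReal_norm]
    _ ≤ ENNReal.ofReal (4 * Real.pi ^ 2) * C * ∫⁻ x, ‖g x‖ₑ ^ 2 ∂μ := by
        set K : X × X → ℝ≥0∞ := fun p => ENNReal.ofReal (G (Φ p.1 - Φ p.2))
        have hK : Measurable K := (hGm.comp hdiff).ennreal_ofReal
        have hg2 : AEMeasurable (fun x => ‖g x‖ₑ ^ 2) μ := hg.1.enorm.pow_const 2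
        have hKg : AEMeasurable (fun p : X × X => K p * ‖g p.1‖ₑ ^ 2) (μ.prod μ) :=
          hK.aemeasurable.mul
            (hg2.comp_quasiMeasurePreserving Measure.quasiMeasurePreserving_fst)
        -- Schur test: this row bound is uniform in `x` and `ε`, and the symmetry of `K` gives the
        -- same bound for columns.
        have hrow : ∀ x, ∫⁻ y, K (x, y) ∂μ ≤ C * ENNReal.ofReal (4 * Real.pi ^ 2) := fun x => by
          refine (hC (fun v => ENNReal.ofReal (G (Φ x - v)))
            (hGm.comp (measurable_const.sub measurable_id)).ennreal_ofReal).trans_eq ?_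
          rw [lintegral_sub_left_eq_self (fun v => ENNReal.ofReal (G v)) (Φ x),
            lintegral_gaussian hε]
        have hsymm : ∀ x y, K (x, y) = K (y, x) := fun x y => by
          simp only [K]
          rw [← hGneg, neg_sub]
        have h1 : ∫⁻ p, K p * ‖g p.1‖ₑ ^ 2 ∂μ.prod μ ≤
            ENNReal.ofReal (4 * Real.pi ^ 2) * C * ∫⁻ x, ‖g x‖ₑ ^ 2 ∂μ := by
          rw [lintegral_prod _ hKg, ← lintegral_const_mul'' _ hg2]
          refine lintegral_mono fun x => ?_
          simp only
          have hKx : Measurable fun y => K (x, y) := hK.comp measurable_prodMk_left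
          rw [lintegral_mul_const _ hKx, mul_comm _ C]
          gcongr
          exact hrow x
        have h2 : ∫⁻ p, K p * ‖g p.2‖ₑ ^ 2 ∂μ.prod μ = ∫⁻ p, K p * ‖g p.1‖ₑ ^ 2 ∂μ.prod μ := by
          rw [← lintegral_prod_swap]
          refine lintegral_congr fun p => ?_
          simp only [Prod.snd_swap]
          rw [show p.swap = (p.2, p.1) from rfl, hsymm]
        have h3 : 2 * ∫⁻ p, K p * (‖g p.1‖ₑ * ‖g p.2‖ₑ) ∂μ.prod μ ≤
            2 * (ENNReal.ofReal (4 * Real.pi ^ 2) * C * ∫⁻ x, ‖g x‖ₑ ^ 2 ∂μ) := by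
          rw [← lintegral_const_mul' _ _ (by simp)]
          calc _ ≤ ∫⁻ p, (K p * ‖g p.1‖ₑ ^ 2 + K p * ‖g p.2‖ₑ ^ 2) ∂μ.prod μ := by
                refine lintegral_mono fun p => ?_
                simp only
                rw [mul_left_comm, ← mul_add]
                gcongr
                exact ennreal_two_mul_le_add_sq _ _
            _ = _ := by
                rw [lintegral_add_left' hKg, h2, ← two_mul]
            _ ≤ _ := by gcongr
        exact (ENNReal.mul_le_mul_iff_right (by simp) (by simp)).1 h3

/-- An `L²` bound for Fourier transforms of measures with bounded density. -/
theorem lintegral_extension_sq_le {μ : Measure X} [SFinite μ] {Φ : X → Plane}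
    (hΦ : Measurable Φ) {C : ℝ≥0∞}
    (hC : ∀ h : Plane → ℝ≥0∞, Measurable h → ∫⁻ x, h (Φ x) ∂μ ≤ C * ∫⁻ v, h v)
    {g : X → ℂ} (hg : Integrable g μ) :
    ∫⁻ ξ, ‖extension μ Φ g ξ‖ₑ ^ 2 ≤
      ENNReal.ofReal (4 * Real.pi ^ 2) * C * ∫⁻ x, ‖g x‖ₑ ^ 2 ∂μ := by
  have hUc := continuous_extension hΦ hg
  -- The damping `1/(n+1)` tends to `0` while the bound stays fixed, so Fatou's lemma concludes.
  let F : ℕ → Plane → ℝ≥0∞ := fun n ξ =>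
    ENNReal.ofReal (Real.exp (-(1 / ((n : ℝ) + 1)) * ‖ξ‖ ^ 2)) * ‖extension μ Φ g ξ‖ₑ ^ 2
  have hlim : ∀ ξ, Filter.Tendsto (fun n => F n ξ) Filter.atTop
      (nhds (‖extension μ Φ g ξ‖ₑ ^ 2)) := fun ξ => by
    have h1 : Filter.Tendsto (fun n : ℕ => Real.exp (-(1 / ((n : ℝ) + 1)) * ‖ξ‖ ^ 2))
        Filter.atTop (nhds 1) := by
      have h2 := (tendsto_one_div_add_atTop_nhds_zero_nat (𝕜 := ℝ)).neg.mul_const (‖ξ‖ ^ 2)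
      simpa [Function.comp_def] using (Real.continuous_exp.tendsto _).comp h2
    have h3 := ENNReal.Tendsto.mul_const (b := ‖extension μ Φ g ξ‖ₑ ^ 2)
      (ENNReal.tendsto_ofReal h1) (Or.inl (by simp))
    simpa [F] using h3
  calc _ = ∫⁻ ξ, Filter.liminf (fun n => F n ξ) Filter.atTop :=
        lintegral_congr fun ξ => (hlim ξ).liminf_eq.symm
    _ ≤ Filter.liminf (fun n => ∫⁻ ξ, F n ξ) Filter.atTop := by
        refine lintegral_liminf_le fun n => ?_
        refine Measurable.mul ?_ (hUc.measurable.enorm.pow_const 2)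
        have : Continuous fun ξ : Plane => Real.exp (-(1 / ((n : ℝ) + 1)) * ‖ξ‖ ^ 2) := by
          fun_prop
        exact this.measurable.ennreal_ofReal
    _ ≤ Filter.liminf (fun _ : ℕ => ENNReal.ofReal (4 * Real.pi ^ 2) * C *
          ∫⁻ x, ‖g x‖ₑ ^ 2 ∂μ) Filter.atTop :=
        Filter.liminf_le_liminf (.of_forall fun n =>
          lintegral_extension_gaussian_le hΦ hC hg (by positivity))
    _ = _ := by simp

/-- The `L² → L⁶` extension estimate for a measure whose threefold convolution has bounded
density, in terms of integrals. -/
theorem lintegral_extension_pow_six_le {μ : Measure X} [SFinite μ] {γ : X → Plane}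
    (hγ : Measurable γ) {C : ℝ≥0∞}
    (hC : ∀ h : Plane → ℝ≥0∞, Measurable h →
      ∫⁻ x, ∫⁻ y, ∫⁻ z, h (γ x + (γ y + γ z)) ∂μ ∂μ ∂μ ≤ C * ∫⁻ v, h v)
    {f : X → ℂ} (hf : Integrable f μ) :
    ∫⁻ ξ, ‖extension μ γ f ξ‖ₑ ^ 6 ≤
      ENNReal.ofReal (4 * Real.pi ^ 2) * C * (∫⁻ x, ‖f x‖ₑ ^ 2 ∂μ) ^ 3 := by
  have hf2 : AEMeasurable (fun x => ‖f x‖ₑ ^ 2) μ := hf.1.enorm.pow_const 2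
  let Φ : X × X × X → Plane := fun p => γ p.1 + (γ p.2.1 + γ p.2.2)
  have hΦ : Measurable Φ := by fun_prop
  have hg : Integrable (fun p : X × X × X => f p.1 * (f p.2.1 * f p.2.2)) (μ.prod (μ.prod μ)) :=
    hf.mul_prod (hf.mul_prod hf)
  -- The `L²` bound is applied to the product measure on triples under the sum map, whose image is
  -- the threefold convolution. The density hypothesis there is exactly `hC`.
  have key := lintegral_extension_sq_le hΦ (C := C) (μ := μ.prod (μ.prod μ)) (fun h hh => by
    rw [lintegral_prod _ (by fun_prop)]
    refine le_trans (lintegral_mono fun x => ?_) (hC h hh)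
    exact (lintegral_prod _ (by fun_prop)).le) hg
  have hU : ∀ ξ, extension (μ.prod (μ.prod μ)) Φ (fun p => f p.1 * (f p.2.1 * f p.2.2)) ξ =
      extension μ γ f ξ ^ 3 := fun ξ => by
    rw [pow_succ', pow_two]
    unfold extension
    rw [← integral_prod_mul, ← integral_prod_mul]
    refine integral_congr_ae (.of_forall fun p => ?_)
    simp only [Φ, kernel_add]
    ring
  have hR : ∫⁻ p : X × X × X, ‖f p.1 * (f p.2.1 * f p.2.2)‖ₑ ^ 2 ∂(μ.prod (μ.prod μ)) =
      (∫⁻ x, ‖f x‖ₑ ^ 2 ∂μ) ^ 3 := by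
    simp only [enorm_mul, mul_pow]
    rw [lintegral_prod_mul (f := fun x => ‖f x‖ₑ ^ 2)
      (g := fun p : X × X => ‖f p.1‖ₑ ^ 2 * ‖f p.2‖ₑ ^ 2) hf2
      ((hf2.comp_quasiMeasurePreserving Measure.quasiMeasurePreserving_fst).mul
      (hf2.comp_quasiMeasurePreserving Measure.quasiMeasurePreserving_snd)),
      lintegral_prod_mul (f := fun x => ‖f x‖ₑ ^ 2) (g := fun x => ‖f x‖ₑ ^ 2) hf2 hf2]
    ring
  rw [hR] at key
  refine le_trans (lintegral_mono fun ξ => ?_) key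
  rw [hU, enorm_pow, ← pow_mul]

end Extension

/-! ### Threefold convolution on a convex graph. -/

/-- Along a ray, the sum of a uniformly convex function over three points with fixed mean has
derivative at least `2r`, so its image measure has density at most `1/2` relative to `r dr`. -/
lemma lintegral_ray_le {J : Set ℝ} (hJ : MeasurableSet J) (hJc : Convex ℝ J) {φ φ' : ℝ → ℝ}
    (hφ : ∀ x ∈ J, HasDerivAt φ (φ' x) x)
    (hmono : ∀ x ∈ J, ∀ y ∈ J, y ≤ x → x - y ≤ φ' x - φ' y)
    {m v₁ v₂ v₃ : ℝ} (hv : v₁ + v₂ + v₃ = 0) (hv2 : v₁ ^ 2 + v₂ ^ 2 + v₃ ^ 2 = 2)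
    (h : ℝ → ℝ≥0∞) :
    2 * ∫⁻ r in {r : ℝ | 0 < r ∧ m + r * v₁ ∈ J ∧ m + r * v₂ ∈ J ∧ m + r * v₃ ∈ J},
      ENNReal.ofReal r * h (φ (m + r * v₁) + (φ (m + r * v₂) + φ (m + r * v₃))) ≤
      ∫⁻ t, h t := by
  set A : Set ℝ := {r : ℝ | 0 < r ∧ m + r * v₁ ∈ J ∧ m + r * v₂ ∈ J ∧ m + r * v₃ ∈ J} with hA
  have hAm : MeasurableSet A := by
    have hm : ∀ v : ℝ, MeasurableSet {r : ℝ | m + r * v ∈ J} := fun v =>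
      (by fun_prop : Measurable fun r : ℝ => m + r * v) hJ
    exact measurableSet_Ioi.inter ((hm v₁).inter ((hm v₂).inter (hm v₃)))
  have hAc : Convex ℝ A := by
    have hm : ∀ v : ℝ, Convex ℝ {r : ℝ | m + r * v ∈ J} := fun v => by
      intro x hx y hy a b ha hb hab
      have := hJc hx hy ha hb hab
      simp only [Set.mem_ofPred_eq, smul_eq_mul] at this ⊢
      convert this using 1
      linear_combination (-m) * hab
    exact (convex_Ioi 0).inter ((hm v₁).inter ((hm v₂).inter (hm v₃)))
  -- `m` is the mean of the three points, since the directions sum to zero; this allows slopes to be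
  -- compared with the slope at `m`.
  have hmJ : ∀ r ∈ A, m ∈ J := by
    rintro r ⟨-, h1, h2, h3⟩
    have h12 := hJc h1 h2 (a := 1 / 2) (b := 1 / 2) (by norm_num) (by norm_num) (by norm_num)
    have := hJc h12 h3 (a := 2 / 3) (b := 1 / 3) (by norm_num) (by norm_num) (by norm_num)
    simp only [smul_eq_mul] at this
    convert this using 1
    linear_combination (-r / 3) * hv
  set Ψ : ℝ → ℝ := fun r => φ (m + r * v₁) + (φ (m + r * v₂) + φ (m + r * v₃))
  set Ψ' : ℝ → ℝ := fun r => φ' (m + r * v₁) * v₁ + (φ' (m + r * v₂) * v₂ + φ' (m + r * v₃) * v₃)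
  have hder : ∀ r ∈ A, HasDerivAt Ψ (Ψ' r) r := by
    rintro r ⟨-, h1, h2, h3⟩
    have hl : ∀ v : ℝ, HasDerivAt (fun r : ℝ => m + r * v) v r := fun v => by
      simpa using ((hasDerivAt_id r).mul_const v).const_add m
    exact ((hφ _ h1).comp r (hl v₁)).add (((hφ _ h2).comp r (hl v₂)).add
      ((hφ _ h3).comp r (hl v₃)))
  have hlow : ∀ r ∈ A, 2 * r ≤ Ψ' r := by
    intro r hr
    have hmm := hmJ r hr
    obtain ⟨hr0, h1, h2, h3⟩ := hr
    have hone : ∀ v : ℝ, m + r * v ∈ J → r * v ^ 2 ≤ (φ' (m + r * v) - φ' m) * v := by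
      intro v hvJ
      rcases le_total 0 v with hv0 | hv0
      · have := hmono _ hvJ _ hmm (by nlinarith)
        nlinarith
      · have := hmono _ hmm _ hvJ (by nlinarith)
        nlinarith
    have e1 := hone v₁ h1
    have e2 := hone v₂ h2
    have e3 := hone v₃ h3
    -- The slope at the mean drops out by `hv`, and the normalization `hv2` turns the left side into
    -- `2r`.
    have e4 : r * (v₁ ^ 2 + v₂ ^ 2 + v₃ ^ 2) ≤ Ψ' r - φ' m * (v₁ + v₂ + v₃) := by
      simp only [Ψ']
      linarith
    rw [hv, hv2] at e4
    linarith
  have hinj : Set.InjOn Ψ A := by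
    refine StrictMonoOn.injOn (strictMonoOn_of_deriv_pos hAc
      (fun r hr => (hder r hr).continuousAt.continuousWithinAt) fun r hr => ?_)
    have hr' := interior_subset hr
    rw [(hder r hr').deriv]
    have := hlow r hr'
    have := hr'.1
    linarith
  rw [← lintegral_const_mul' _ _ (by simp)]
  calc _ ≤ ∫⁻ r in A, ENNReal.ofReal |Ψ' r| * h (Ψ r) := by
        refine setLIntegral_mono' hAm fun r hr => ?_
        rw [← mul_assoc]
        gcongr
        have := hlow r hr
        rw [← ENNReal.ofReal_ofNat 2, ← ENNReal.ofReal_mul (by norm_num)]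
        exact ENNReal.ofReal_le_ofReal (this.trans (le_abs_self _))
    _ = ∫⁻ t in Ψ '' A, h t :=
        (lintegral_image_eq_lintegral_abs_deriv_mul hAm
          (fun r hr => (hder r hr).hasDerivWithinAt) hinj h).symm
    _ ≤ _ := setLIntegral_le_lintegral _ _

lemma lintegral_comp_mul_left_real {c : ℝ} (hc : 0 < c) {G : ℝ → ℝ≥0∞} (hG : Measurable G) :
    ∫⁻ x, G x = ENNReal.ofReal c * ∫⁻ x, G (c * x) := by
  have h := Real.smul_map_volume_mul_left hc.ne'
  rw [abs_of_pos hc] at h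
  rw [← lintegral_map hG (measurable_const_mul c), ← smul_eq_mul, ← lintegral_smul_measure, h]

/-- The shear makes the quadratic form round: with `a = p - q/√3` and `b = 2q/√3`, `a² + b² + (a +
b)² = 2(p² + q²)`. Its Jacobian is the source of `√3` in the density bound. -/
lemma lintegral_prod_shear {G : ℝ × ℝ → ℝ≥0∞} (hG : Measurable G) :
    ∫⁻ P, G P = ENNReal.ofReal (2 / √3) *
      ∫⁻ Q : ℝ × ℝ, G (Q.1 - Q.2 / √3, 2 / √3 * Q.2) := by
  have h3 : 0 < √3 := by positivity
  rw [Measure.volume_eq_prod, lintegral_prod_symm _ hG.aemeasurable,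
    lintegral_prod_symm _ (by fun_prop),
    lintegral_comp_mul_left_real (c := 2 / √3) (by positivity) (by fun_prop)]
  congr 1
  refine lintegral_congr fun b => ?_
  exact (lintegral_sub_right_eq_self (fun a => G (a, 2 / √3 * b)) (b / √3)).symm

lemma lintegral_polar {G : ℝ × ℝ → ℝ≥0∞} (hG : Measurable G) :
    ∫⁻ P, G P = ∫⁻ θ in Set.Ioo (-Real.pi) Real.pi, ∫⁻ r in Set.Ioi (0 : ℝ),
      ENNReal.ofReal r * G (r * Real.cos θ, r * Real.sin θ) := by
  rw [← lintegral_comp_polarCoord_symm, polarCoord_target, Measure.volume_eq_prod,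
    ← Measure.prod_restrict, lintegral_prod_symm]
  · rfl
  · simp only [smul_eq_mul, polarCoord_symm_apply]
    fun_prop

/-- The threefold convolution of `dx` on a uniformly convex graph has density at most
`2π / √3`. -/
theorem lintegral_graph_convolution_le {J : Set ℝ} (hJ : MeasurableSet J) (hJc : Convex ℝ J)
    {φ φ' : ℝ → ℝ} (hφm : Measurable φ) (hφ : ∀ x ∈ J, HasDerivAt φ (φ' x) x)
    (hmono : ∀ x ∈ J, ∀ y ∈ J, y ≤ x → x - y ≤ φ' x - φ' y)
    {h : ℝ × ℝ → ℝ≥0∞} (hh : Measurable h) :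
    ∫⁻ x in J, ∫⁻ y in J, ∫⁻ z in J, h (x + (y + z), φ x + (φ y + φ z)) ≤
      ENNReal.ofReal (2 * Real.pi / √3) * ∫⁻ p, h p := by
  have h3 : 0 < √3 := by positivity
  have h33 : √3 ^ 2 = 3 := Real.sq_sqrt (by norm_num)
  let S : Set (ℝ × ℝ × ℝ) := J ×ˢ (J ×ˢ J)
  have hS : MeasurableSet S := hJ.prod (hJ.prod hJ)
  -- Extending by zero off `J³` lets translations and linear changes of variables act on the whole
  -- space.
  let k : ℝ × ℝ × ℝ → ℝ≥0∞ := S.indicator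
    fun p => h (p.1 + (p.2.1 + p.2.2), φ p.1 + (φ p.2.1 + φ p.2.2))
  have hk : Measurable k := by
    refine Measurable.indicator ?_ hS
    fun_prop
  have hray : ∀ s θ : ℝ, 2 * ∫⁻ r in Set.Ioi (0 : ℝ), ENNReal.ofReal r *
      k (s - (s / 3 + (r * Real.cos θ - r * Real.sin θ / √3)) -
          (s / 3 + 2 / √3 * (r * Real.sin θ)),
        s / 3 + (r * Real.cos θ - r * Real.sin θ / √3), s / 3 + 2 / √3 * (r * Real.sin θ)) ≤
      ∫⁻ t, h (s, t) := by
    intro s θ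
    set v₂ := Real.cos θ - Real.sin θ / √3 with hv₂
    set v₃ := 2 / √3 * Real.sin θ with hv₃
    have hsum : (-v₂ - v₃) + v₂ + v₃ = 0 := by ring
    have hsq : (-v₂ - v₃) ^ 2 + v₂ ^ 2 + v₃ ^ 2 = 2 := by
      have hcs := Real.sin_sq_add_cos_sq θ
      rw [hv₂, hv₃]
      field_simp
      rw [h33]
      linear_combination 6 * hcs + 2 * Real.cos θ ^ 2 * h33
    refine le_trans (le_of_eq ?_) (lintegral_ray_le hJ hJc hφ hmono (m := s / 3) hsum hsq
      (fun t => h (s, t)))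
    congr 1
    rw [← lintegral_indicator measurableSet_Ioi, ← lintegral_indicator]
    · refine lintegral_congr fun r => ?_
      have e2 : s / 3 + (r * Real.cos θ - r * Real.sin θ / √3) = s / 3 + r * v₂ := by
        rw [hv₂]; ring
      have e3 : s / 3 + 2 / √3 * (r * Real.sin θ) = s / 3 + r * v₃ := by
        rw [hv₃]; ring
      have e1 : s - (s / 3 + r * v₂) - (s / 3 + r * v₃) = s / 3 + r * (-v₂ - v₃) := by ring
      have e4 : s / 3 + r * (-v₂ - v₃) + (s / 3 + r * v₂ + (s / 3 + r * v₃)) = s := by ring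
      by_cases hr : 0 < r
      · rw [Set.indicator_of_mem (by exact hr), e2, e3, e1]
        by_cases hm : (s / 3 + r * (-v₂ - v₃), s / 3 + r * v₂, s / 3 + r * v₃) ∈ S
        · rw [Set.indicator_of_mem (by exact ⟨hr, hm⟩)]
          simp only [k]
          rw [Set.indicator_of_mem hm]
          simp only [e4]
        · rw [Set.indicator_of_notMem (by exact fun hc => hm hc.2)]
          simp only [k]
          rw [Set.indicator_of_notMem hm, mul_zero]
      · rw [Set.indicator_of_notMem (by exact hr),
          Set.indicator_of_notMem (by exact fun hc => hr hc.1)]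
    · have hm : ∀ v : ℝ, MeasurableSet {r : ℝ | s / 3 + r * v ∈ J} := fun v =>
        (by fun_prop : Measurable fun r : ℝ => s / 3 + r * v) hJ
      exact measurableSet_Ioi.inter ((hm _).inter ((hm _).inter (hm _)))
  have hplane : ∀ s : ℝ, ∫⁻ P : ℝ × ℝ, k (s - P.1 - P.2, P.1, P.2) ≤
      ENNReal.ofReal (2 * Real.pi / √3) * ∫⁻ t, h (s, t) := by
    intro s
    -- The origin moves to the barycentre `(s/3, s/3, s/3)`. The final constant is the Jacobian
    -- `2/√3`, times the angle `2π`, times the `1/2` from each ray.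
    calc _ = ∫⁻ P : ℝ × ℝ, k (s - (s / 3 + P.1) - (s / 3 + P.2), s / 3 + P.1, s / 3 + P.2) :=
          (lintegral_add_left_eq_self
            (fun P : ℝ × ℝ => k (s - P.1 - P.2, P.1, P.2)) (s / 3, s / 3)).symm
      _ = ENNReal.ofReal (2 / √3) * ∫⁻ θ in Set.Ioo (-Real.pi) Real.pi,
          ∫⁻ r in Set.Ioi (0 : ℝ), ENNReal.ofReal r *
          k (s - (s / 3 + (r * Real.cos θ - r * Real.sin θ / √3)) -
              (s / 3 + 2 / √3 * (r * Real.sin θ)),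
            s / 3 + (r * Real.cos θ - r * Real.sin θ / √3),
            s / 3 + 2 / √3 * (r * Real.sin θ)) := by
          rw [lintegral_prod_shear (by fun_prop), lintegral_polar (by fun_prop)]
      _ ≤ ENNReal.ofReal (2 / √3) * ∫⁻ θ in Set.Ioo (-Real.pi) Real.pi,
          2⁻¹ * ∫⁻ t, h (s, t) := by
          gcongr with θ
          rw [← ENNReal.mul_le_iff_le_inv (by simp) (by simp)]
          exact hray s θ
      _ = _ := by
          rw [setLIntegral_const, Real.volume_Ioo, mul_right_comm, ← mul_assoc, ← mul_assoc]
          congr 1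
          have h2 : (2 : ℝ≥0∞)⁻¹ = ENNReal.ofReal (1 / 2) := by
            rw [one_div, ENNReal.ofReal_inv_of_pos (by norm_num)]
            simp
          have := Real.pi_pos
          rw [h2, ← ENNReal.ofReal_mul (by positivity), ← ENNReal.ofReal_mul (by positivity)]
          congr 1
          ring
  calc _ = ∫⁻ x, ∫⁻ P : ℝ × ℝ, k (x, P) := by
        rw [← lintegral_indicator hJ]
        refine lintegral_congr fun x => ?_
        by_cases hx : x ∈ J
        · rw [Set.indicator_of_mem hx, Measure.volume_eq_prod, lintegral_prod _ (by fun_prop),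
            ← lintegral_indicator hJ]
          refine lintegral_congr fun y => ?_
          by_cases hy : y ∈ J
          · rw [Set.indicator_of_mem hy, ← lintegral_indicator hJ]
            refine lintegral_congr fun z => ?_
            by_cases hz : z ∈ J
            · rw [Set.indicator_of_mem hz]
              simp only [k]
              rw [Set.indicator_of_mem (show (x, y, z) ∈ S from ⟨hx, hy, hz⟩)]
            · rw [Set.indicator_of_notMem hz]
              exact (Set.indicator_of_notMem (fun hc : (x, y, z) ∈ S => hz hc.2.2) _).symm
          · rw [Set.indicator_of_notMem hy]
            symm
            refine (lintegral_congr fun z => ?_).trans lintegral_zero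
            exact Set.indicator_of_notMem (fun hc : (x, y, z) ∈ S => hy hc.2.1) _
        · rw [Set.indicator_of_notMem hx]
          symm
          refine (lintegral_congr fun z => ?_).trans lintegral_zero
          exact Set.indicator_of_notMem (fun hc : (x, z) ∈ S => hx hc.1) _
    _ = ∫⁻ P : ℝ × ℝ, ∫⁻ x, k (x, P) :=
        lintegral_lintegral_swap (f := fun x P => k (x, P)) (by exact hk.aemeasurable)
    -- The first variable is replaced by the sum `s` of all three, which slices space by the first
    -- coordinate of the convolution.
    _ = ∫⁻ P : ℝ × ℝ, ∫⁻ s, k (s - P.1 - P.2, P) := by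
        refine lintegral_congr fun P => ?_
        simp only [sub_sub]
        exact (lintegral_sub_right_eq_self (fun x => k (x, P)) (P.1 + P.2)).symm
    _ = ∫⁻ s, ∫⁻ P : ℝ × ℝ, k (s - P.1 - P.2, P) :=
        lintegral_lintegral_swap (f := fun P s => k (s - P.1 - P.2, P))
          (by
            refine Measurable.aemeasurable ?_
            simp only [Function.uncurry_def]
            fun_prop)
    _ ≤ ∫⁻ s, ENNReal.ofReal (2 * Real.pi / √3) * ∫⁻ t, h (s, t) := lintegral_mono hplane
    _ = _ := by
        rw [lintegral_const_mul' _ _ (by simp), Measure.volume_eq_prod,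
          lintegral_prod _ hh.aemeasurable]

lemma measurePreserving_toLp_pair :
    MeasurePreserving (fun p : ℝ × ℝ => (!₂[p.1, p.2] : Plane)) :=
  (EuclideanSpace.volume_preserving_symm_measurableEquiv_toLp (Fin 2)).symm.comp
    (volume_preserving_finTwoArrow ℝ).symm

theorem lintegral_graph_convolution_plane_le {J : Set ℝ} (hJ : MeasurableSet J)
    (hJc : Convex ℝ J) {φ φ' : ℝ → ℝ} (hφm : Measurable φ)
    (hφ : ∀ x ∈ J, HasDerivAt φ (φ' x) x)
    (hmono : ∀ x ∈ J, ∀ y ∈ J, y ≤ x → x - y ≤ φ' x - φ' y)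
    {h : Plane → ℝ≥0∞} (hh : Measurable h) :
    ∫⁻ x in J, ∫⁻ y in J, ∫⁻ z in J,
      h ((!₂[x, φ x] : Plane) + ((!₂[y, φ y] : Plane) + (!₂[z, φ z] : Plane))) ≤
      ENNReal.ofReal (2 * Real.pi / √3) * ∫⁻ p, h p := by
  have key := lintegral_graph_convolution_le hJ hJc hφm hφ hmono
    (hh.comp measurePreserving_toLp_pair.measurable)
  rw [← measurePreserving_toLp_pair.lintegral_comp hh]
  refine le_trans (le_of_eq ?_) key
  refine lintegral_congr fun x => lintegral_congr fun y => lintegral_congr fun z => ?_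
  simp only [Function.comp_apply]
  congr 1
  ext i
  fin_cases i <;> simp

/-! ### The `L² → L⁶` estimate and the multiplication formula. -/

section General

variable {X : Type*} [MeasurableSpace X]

/-- The `L² → L⁶` extension estimate for a measure whose threefold convolution has bounded
density. -/
theorem eLpNorm_extension_le {μ : Measure X} [SFinite μ] {γ : X → Plane}
    (hγ : Measurable γ) {C : ℝ≥0∞}
    (hC : ∀ h : Plane → ℝ≥0∞, Measurable h →
      ∫⁻ x, ∫⁻ y, ∫⁻ z, h (γ x + (γ y + γ z)) ∂μ ∂μ ∂μ ≤ C * ∫⁻ v, h v)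
    {f : X → ℂ} (hf : Integrable f μ) :
    eLpNorm (extension μ γ f) 6 volume ≤
      (ENNReal.ofReal (4 * Real.pi ^ 2) * C) ^ (1 / 6 : ℝ) * eLpNorm f 2 μ := by
  have key := lintegral_extension_pow_six_le hγ hC hf
  rw [eLpNorm_eq_lintegral_rpow_enorm_toReal (by simp) (by simp),
    eLpNorm_eq_lintegral_rpow_enorm_toReal (by simp) (by simp)]
  simp only [ENNReal.toReal_ofNat]
  have e6 : ∀ a : ℝ≥0∞, a ^ (6 : ℝ) = a ^ 6 := fun a => by exact_mod_cast ENNReal.rpow_natCast a 6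
  have e2 : ∀ a : ℝ≥0∞, a ^ (2 : ℝ) = a ^ 2 := fun a => by exact_mod_cast ENNReal.rpow_natCast a 2
  simp only [e6, e2]
  refine (ENNReal.rpow_le_rpow key (by norm_num)).trans_eq ?_
  rw [ENNReal.mul_rpow_of_nonneg _ _ (by norm_num), ← ENNReal.rpow_natCast, ← ENNReal.rpow_mul]
  norm_num

lemma extension_sub {μ : Measure X} {γ : X → Plane} (hγ : Measurable γ) {f g : X → ℂ}
    (hf : Integrable f μ) (hg : Integrable g μ) :
    extension μ γ (f - g) = extension μ γ f - extension μ γ g := by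
  ext ξ
  simp only [extension, Pi.sub_apply, mul_sub]
  exact integral_sub (integrable_kernel_mul hγ hf ξ) (integrable_kernel_mul hγ hg ξ)

/-- The multiplication formula for the Fourier transform of a measure. -/
lemma integral_extension_mul {μ : Measure X} [SFinite μ] {γ : X → Plane} (hγ : Measurable γ)
    {f : X → ℂ} (hf : Integrable f μ) {φ : Plane → ℂ} (hφ : Integrable φ) :
    ∫ ξ, extension μ γ f ξ * φ ξ = ∫ x, f x * ∫ ξ, kernel (γ x) ξ * φ ξ ∂volume ∂μ := by
  have h1 : Integrable (fun q : Plane × X => φ q.1 * f q.2) (volume.prod μ) := hφ.mul_prod hf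
  have hk : Measurable fun q : Plane × X => kernel q.1 (γ q.2) :=
    measurable_kernel_comp measurable_fst (hγ.comp measurable_snd)
  have hint : Integrable (fun q : Plane × X => kernel q.1 (γ q.2) * (φ q.1 * f q.2))
      (volume.prod μ) :=
    h1.mono (hk.aestronglyMeasurable.mul h1.1) (.of_forall fun q => by
      rw [norm_mul, norm_kernel, one_mul])
  calc _ = ∫ ξ, ∫ x, kernel ξ (γ x) * (φ ξ * f x) ∂μ := by
        refine integral_congr_ae (.of_forall fun ξ => ?_)
        simp only [extension]
        rw [← integral_mul_const]
        refine integral_congr_ae (.of_forall fun x => ?_)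
        simp only
        ring
    _ = ∫ x, ∫ ξ, kernel ξ (γ x) * (φ ξ * f x) ∂volume ∂μ :=
        integral_integral_swap hint
    _ = _ := by
        refine integral_congr_ae (.of_forall fun x => ?_)
        simp only
        rw [← integral_const_mul]
        refine integral_congr_ae (.of_forall fun ξ => ?_)
        simp only
        rw [kernel_comm]
        ring

end General

/-! ### The upper bound for the parabola. -/

lemma measurable_parabolaParam : Measurable parabolaParam := by
  refine Measurable.subtype_mk ?_
  have : Continuous fun y : ℝ => (!₂[y, y ^ 2 / 2] : Plane) := by fun_prop
  exact this.measurable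

lemma measurableEmbedding_parabolaParam : MeasurableEmbedding parabolaParam := by
  refine MeasurableEmbedding.of_measurable_inverse_on_range (g := fun p => (p : Plane) 0)
    measurable_parabolaParam ?_ ?_ ?_
  · have : Set.range parabolaParam = Set.univ := by
      refine Set.eq_univ_of_forall fun p => ⟨(p : Plane) 0, ?_⟩
      ext i
      have := p.2
      simp only [parabola, Set.mem_ofPred_eq] at this
      fin_cases i <;> simp [parabolaParam, this]
    rw [this]
    exact MeasurableSet.univ
  · fun_prop
  · intro y
    simp [parabolaParam]

/-- The Fourier transform of a Schwartz function, in the normalization of `kernel`. -/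
lemma integral_kernel_mul_schwartz (φ : SchwartzMap Plane ℂ) (v : Plane) :
    ∫ ξ, kernel v ξ * φ ξ = 𝓕 φ ((2 * Real.pi)⁻¹ • v) := by
  rw [SchwartzMap.fourier_coe, Real.fourier_eq']
  refine integral_congr_ae (.of_forall fun ξ => ?_)
  simp only [kernel, smul_eq_mul]
  congr 2
  rw [real_inner_smul_right, real_inner_comm]
  have : (Real.pi : ℂ) ≠ 0 := by exact_mod_cast Real.pi_ne_zero
  push_cast
  field_simp

/-- The restriction to the parabola of a Fourier transform of a Schwartz function is square
integrable. -/
lemma memLp_schwartz_parabola (φ : SchwartzMap Plane ℂ) :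
    MemLp (fun y : ℝ => ∫ ξ, kernel (parabolaParam y) ξ * φ ξ) 2 volume := by
  simp only [integral_kernel_mul_schwartz]
  -- Decay of orders 0 and 1 suffices: along the parabola the norm dominates `|y|`, so the square is
  -- bounded by a multiple of `1/(1 + y²)`.
  obtain ⟨A, hA, hA'⟩ := (𝓕 φ).decay 0 0
  obtain ⟨B, hB, hB'⟩ := (𝓕 φ).decay 1 0
  simp only [norm_iteratedFDeriv_zero, pow_zero, one_mul, pow_one] at hA' hB'
  have hc : Continuous fun y : ℝ => 𝓕 φ ((2 * Real.pi)⁻¹ • (parabolaParam y : Plane)) := by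
    have : Continuous fun y : ℝ => (2 * Real.pi)⁻¹ • (parabolaParam y : Plane) := by
      simp only [parabolaParam]
      fun_prop
    exact (𝓕 φ).continuous.comp this
  rw [memLp_two_iff_integrable_sq_norm hc.aestronglyMeasurable]
  refine (integrable_inv_one_add_sq.const_mul (A ^ 2 + (2 * Real.pi * B) ^ 2)).mono'
    (hc.norm.pow 2).aestronglyMeasurable (.of_forall fun y => ?_)
  rw [Real.norm_of_nonneg (by positivity), ← div_eq_mul_inv, le_div_iff₀ (by positivity)]
  set w := 𝓕 φ ((2 * Real.pi)⁻¹ • (parabolaParam y : Plane))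
  have h1 : ‖w‖ ≤ A := hA' _
  have h2 := hB' ((2 * Real.pi)⁻¹ • (parabolaParam y : Plane))
  have hy : |y| ≤ ‖(parabolaParam y : Plane)‖ := by
    have := PiLp.norm_apply_le (parabolaParam y : Plane) 0
    simpa [parabolaParam] using this
  have h3 : |y| * ‖w‖ ≤ 2 * Real.pi * B := by
    rw [norm_smul, Real.norm_of_nonneg (by positivity), mul_assoc,
      inv_mul_le_iff₀ (by positivity)] at h2
    exact le_trans (by gcongr) h2
  have h4 : ‖w‖ ^ 2 ≤ A ^ 2 := by gcongr
  have h5 : (|y| * ‖w‖) ^ 2 ≤ (2 * Real.pi * B) ^ 2 := by gcongr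
  rw [mul_pow, sq_abs] at h5
  linarith

/-- Truncations are integrable, so their transforms are honest integrals; this convergence carries
the estimate to all of `L²`. -/
lemma tendsto_eLpNorm_truncation {f : ℝ → ℂ} (hf : MemLp f 2 volume) :
    Tendsto (fun n : ℕ => eLpNorm ((Set.Icc (-(n : ℝ)) n).indicator f - f) 2 volume) atTop
      (𝓝 0) := by
  simp only [eLpNorm_eq_lintegral_rpow_enorm_toReal (two_ne_zero) (ENNReal.ofNat_ne_top)]
  rw [show (0 : ℝ≥0∞) = 0 ^ (1 / (2 : ℝ≥0∞).toReal) by simp]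
  refine (ENNReal.continuous_rpow_const.tendsto 0).comp ?_
  rw [← lintegral_zero (μ := (volume : Measure ℝ))]
  refine tendsto_lintegral_of_dominated_convergence' (fun y => ‖f y‖ₑ ^ (2 : ℝ≥0∞).toReal)
    (fun n => ?_) (fun n => .of_forall fun y => ?_) ?_ (.of_forall fun y => ?_)
  · exact ((hf.1.indicator measurableSet_Icc).sub hf.1).enorm.pow_const _
  · simp only [Pi.sub_apply]
    by_cases hy : y ∈ Set.Icc (-(n : ℝ)) n
    · simp [Set.indicator_of_mem hy]
    · simp [Set.indicator_of_notMem hy]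
  · exact (lintegral_rpow_enorm_lt_top_of_eLpNorm_lt_top (by simp) (by simp) hf.2).ne
  · refine tendsto_const_nhds.congr' ?_
    filter_upwards [eventually_ge_atTop ⌈|y|⌉₊] with n hn
    have h1 : |y| ≤ n := (Nat.le_ceil _).trans (by exact_mod_cast hn)
    have : y ∈ Set.Icc (-(n : ℝ)) n := abs_le.1 h1
    simp [Set.indicator_of_mem this]

/-- The constant in the extension estimate for the parabola. -/
noncomputable def parabolaBound : ℝ≥0∞ :=
  (ENNReal.ofReal (4 * Real.pi ^ 2) * ENNReal.ofReal (2 * Real.pi / √3)) ^ (1 / 6 : ℝ)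

lemma parabolaBound_ne_top : parabolaBound ≠ ⊤ :=
  ENNReal.rpow_ne_top_of_nonneg (by norm_num)
    (ENNReal.mul_ne_top ENNReal.ofReal_ne_top ENNReal.ofReal_ne_top)

/-- For `φ = x²/2` the slope is `x`, so the monotonicity hypothesis holds with equality. -/
lemma eLpNorm_extension_parabola_le {f : ℝ → ℂ} (hf : Integrable f) :
    eLpNorm (extension volume (fun y => (parabolaParam y : Plane)) f) 6 volume ≤
      parabolaBound * eLpNorm f 2 volume := by
  refine eLpNorm_extension_le (measurable_subtype_coe.comp measurable_parabolaParam)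
    (fun h hh => ?_) hf
  have := lintegral_graph_convolution_plane_le MeasurableSet.univ convex_univ
    (φ := fun x => x ^ 2 / 2) (φ' := fun x => x) (by fun_prop)
    (fun x _ => by simpa using (hasDerivAt_pow 2 x).div_const 2) (fun x _ y _ _ => le_rfl) hh
  simp only [Measure.restrict_univ] at this
  exact this

/-- Density argument: transforms of truncations are Cauchy in `L⁶` by the estimate applied to
differences. The multiplication formula holds for each truncation, and both of its sides pass to the
limit. -/
theorem exists_parabola_extension {f : ℝ → ℂ} (hf : MemLp f 2 volume) :
    ∃ u : Plane → ℂ, MemLp u 6 volume ∧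
      eLpNorm u 6 volume ≤ parabolaBound * eLpNorm f 2 volume ∧
      ∀ φ : SchwartzMap Plane ℂ, ∫ ξ, u ξ * φ ξ =
        ∫ y : ℝ, f y * ∫ ξ, kernel (parabolaParam y) ξ * φ ξ := by
  have hγ : Measurable fun y => (parabolaParam y : Plane) :=
    measurable_subtype_coe.comp measurable_parabolaParam
  let F : ℕ → ℝ → ℂ := fun n => (Set.Icc (-(n : ℝ)) n).indicator f
  have hF2 : ∀ n, MemLp (F n) 2 volume := fun n => hf.indicator measurableSet_Icc
  have hF1 : ∀ n, Integrable (F n) := fun n => by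
    refine (integrable_indicator_iff measurableSet_Icc).2 ?_
    exact (hf.restrict _).integrable (by norm_num)
  let U : ℕ → Plane → ℂ := fun n => extension volume (fun y => (parabolaParam y : Plane)) (F n)
  have hUle : ∀ n, eLpNorm (U n) 6 volume ≤ parabolaBound * eLpNorm (F n) 2 volume :=
    fun n => eLpNorm_extension_parabola_le (hF1 n)
  have hU : ∀ n, MemLp (U n) 6 volume := fun n =>
    ⟨(continuous_extension hγ (hF1 n)).aestronglyMeasurable,
      (hUle n).trans_lt (ENNReal.mul_lt_top parabolaBound_ne_top.lt_top (hF2 n).2)⟩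
  have : Fact ((1 : ℝ≥0∞) ≤ 6) := ⟨by norm_num⟩
  let FL : ℕ → Lp ℂ 2 (volume : Measure ℝ) := fun n => (hF2 n).toLp
  let UL : ℕ → Lp ℂ 6 (volume : Measure Plane) := fun n => (hU n).toLp
  have hFL : Tendsto FL atTop (𝓝 hf.toLp) := by
    rw [tendsto_iff_edist_tendsto_0]
    simp only [FL, Lp.edist_toLp_toLp]
    exact tendsto_eLpNorm_truncation hf
  have hdist : ∀ n m, dist (UL n) (UL m) ≤ parabolaBound.toReal * dist (FL n) (FL m) := by
    intro n m
    rw [dist_edist, dist_edist, ← ENNReal.toReal_mul]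
    refine ENNReal.toReal_mono (ENNReal.mul_ne_top parabolaBound_ne_top (edist_ne_top _ _)) ?_
    simp only [UL, FL, Lp.edist_toLp_toLp]
    rw [← extension_sub hγ (hF1 n) (hF1 m)]
    exact eLpNorm_extension_parabola_le ((hF1 n).sub (hF1 m))
  have hcau : CauchySeq UL := by
    rw [cauchySeq_iff_tendsto_dist_atTop_0]
    have h1 := (cauchySeq_iff_tendsto_dist_atTop_0.1 hFL.cauchySeq).const_mul
      parabolaBound.toReal
    rw [mul_zero] at h1
    exact squeeze_zero (fun _ => dist_nonneg) (fun p => hdist p.1 p.2) h1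
  obtain ⟨u, hu⟩ := cauchySeq_tendsto_of_complete hcau
  refine ⟨u, Lp.memLp u, ?_, fun φ => ?_⟩
  · have h1 : Tendsto (fun n => ‖UL n‖ₑ) atTop (𝓝 ‖u‖ₑ) := hu.enorm
    rw [← Lp.enorm_def]
    refine le_of_tendsto' h1 fun n => ?_
    rw [Lp.enorm_toLp]
    refine (hUle n).trans ?_
    gcongr
    exact eLpNorm_indicator_le f
  · have hlim1 : Tendsto (fun n => ∫ ξ, U n ξ * φ ξ) atTop (𝓝 (∫ ξ, u ξ * φ ξ)) := by
      -- Pairing with a fixed Schwartz function, which lies in the dual space `L^{6/5}`, is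
      -- continuous on `L⁶`.
      have : ENNReal.HolderConjugate 6 (1 - (6 : ℝ≥0∞)⁻¹)⁻¹ :=
        ENNReal.HolderConjugate.inv_one_sub_inv' (by norm_num)
      have hq : MemLp φ (1 - (6 : ℝ≥0∞)⁻¹)⁻¹ volume := φ.memLp _ _
      have : Fact ((1 : ℝ≥0∞) ≤ (1 - (6 : ℝ≥0∞)⁻¹)⁻¹) := by simp [fact_iff]
      let T := (ContinuousLinearMap.mul ℂ ℂ).lpPairing (volume : Measure Plane) 6
        (1 - (6 : ℝ≥0∞)⁻¹)⁻¹
      have hT : Continuous fun v => T v hq.toLp := (T.flip hq.toLp).continuous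
      have h1 := (hT.tendsto u).comp hu
      simp only [T, Function.comp_def, ContinuousLinearMap.lpPairing_eq_integral,
        ContinuousLinearMap.mul_apply'] at h1
      have h2 : ∫ ξ, u ξ * hq.toLp φ ξ = ∫ ξ, u ξ * φ ξ := by
        refine integral_congr_ae ?_
        filter_upwards [hq.coeFn_toLp] with ξ h
        rw [h]
      rw [h2] at h1
      refine h1.congr fun n => integral_congr_ae ?_
      filter_upwards [hq.coeFn_toLp, (hU n).coeFn_toLp] with ξ h h'
      rw [h, h']
    have hlim2 : Tendsto (fun n => ∫ y : ℝ, F n y * ∫ ξ, kernel (parabolaParam y) ξ * φ ξ) atTop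
        (𝓝 (∫ y : ℝ, f y * ∫ ξ, kernel (parabolaParam y) ξ * φ ξ)) := by
      have hφ := memLp_schwartz_parabola φ
      refine tendsto_integral_of_dominated_convergence
        (fun y => ‖f y * ∫ ξ, kernel (parabolaParam y) ξ * φ ξ‖)
        (fun n => (hF2 n).1.mul hφ.1) (hf.integrable_mul hφ).norm
        (fun n => .of_forall fun y => ?_) (.of_forall fun y => ?_)
      · rw [norm_mul, norm_mul]
        gcongr
        exact norm_indicator_le_norm_self f y
      · refine tendsto_const_nhds.congr' ?_
        filter_upwards [eventually_ge_atTop ⌈|y|⌉₊] with n hn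
        have h1 : |y| ≤ n := (Nat.le_ceil _).trans (by exact_mod_cast hn)
        have : y ∈ Set.Icc (-(n : ℝ)) n := abs_le.1 h1
        simp only [F]
        rw [Set.indicator_of_mem this]
    refine tendsto_nhds_unique hlim1 (hlim2.congr fun n => ?_)
    exact (integral_extension_mul hγ (hF1 n) φ.integrable).symm

/-- The extension inequality for the parabola, with its sharp constant. -/
theorem parabolaConst_le : parabolaConst ≤ parabolaBound := by
  refine iSup_le fun f => iSup_le fun hf => iSup_le fun hf0 => ?_
  refine ENNReal.div_le_of_le_mul ?_
  have hemb := measurableEmbedding_parabolaParam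
  have hf' : MemLp (f ∘ parabolaParam) 2 volume := (hemb.memLp_map_measure_iff).1 hf
  obtain ⟨u, hu6, hule, hu⟩ := exists_parabola_extension hf'
  have hnorm : eLpNorm f 2 parabolaMeasure = eLpNorm (f ∘ parabolaParam) 2 volume :=
    hemb.eLpNorm_map_measure
  rw [hnorm]
  refine le_trans (iInf_le_of_le u (iInf_le_of_le hu6 (iInf_le_of_le (fun φ => ?_) le_rfl))) hule
  rw [hu φ, parabolaMeasure, hemb.integral_map]
  rfl

/-! ### Arc length in the angular parametrization. -/

/-- The parametrization of the unit circle by the angle. -/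
noncomputable def circleParam (θ : ℝ) : Circle1 :=
  ⟨!₂[Real.cos θ, Real.sin θ], by simp [EuclideanSpace.norm_eq, Fin.sum_univ_two]⟩

lemma continuous_circleParam_coe : Continuous fun θ => (circleParam θ : Plane) := by
  simp only [circleParam]
  fun_prop

lemma measurable_circleParam : Measurable circleParam :=
  continuous_circleParam_coe.measurable.subtype_mk

lemma lintegral_plane_polar {G : Plane → ℝ≥0∞} (hG : Measurable G) :
    ∫⁻ p, G p = ∫⁻ θ in Set.Ioo (-Real.pi) Real.pi, ∫⁻ r in Set.Ioi (0 : ℝ),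
      ENNReal.ofReal r * G (r • (circleParam θ : Plane)) := by
  rw [← measurePreserving_toLp_pair.lintegral_comp hG]
  refine (lintegral_polar (hG.comp measurePreserving_toLp_pair.measurable)).trans ?_
  refine lintegral_congr fun θ => lintegral_congr fun r => ?_
  simp only [Function.comp_apply]
  congr 2
  ext i
  fin_cases i <;> simp [circleParam]

lemma smul_circleParam_mem_iff {s : Set Circle1} {r θ : ℝ} (hr : 0 < r) :
    r • (circleParam θ : Plane) ∈ Set.Ioo (0 : ℝ) 1 • (Subtype.val '' s : Set Plane) ↔
      r < 1 ∧ circleParam θ ∈ s := by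
  constructor
  · rintro ⟨t, ht, _, ⟨z, hz, rfl⟩, h⟩
    simp only at h
    have hn := congrArg norm h
    rw [norm_smul, norm_smul, norm_eq_of_mem_sphere, norm_eq_of_mem_sphere, mul_one, mul_one,
      Real.norm_of_nonneg ht.1.le, Real.norm_of_nonneg hr.le] at hn
    subst hn
    have : z = circleParam θ := Subtype.ext (smul_right_injective _ hr.ne' h)
    exact ⟨ht.2, this ▸ hz⟩
  · rintro ⟨h1, h2⟩
    exact ⟨r, ⟨hr, h1⟩, _, ⟨_, h2, rfl⟩, rfl⟩

/-- The measure `toSphere` is defined through the volume of this open cone; measurability allows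
that volume to be computed in polar coordinates. -/
lemma measurableSet_Ioo_smul {s : Set Circle1} (hs : MeasurableSet s) :
    MeasurableSet (Set.Ioo (0 : ℝ) 1 • (Subtype.val '' s : Set Plane)) := by
  have hset : Set.Ioo (0 : ℝ) 1 • (Subtype.val '' s : Set Plane) =
      {x : Plane | (0 < ‖x‖ ∧ ‖x‖ < 1) ∧ ‖x‖⁻¹ • x ∈ (Subtype.val '' s : Set Plane)} := by
    ext x
    constructor
    · rintro ⟨t, ht, _, ⟨z, hz, rfl⟩, rfl⟩
      have hn : ‖t • (z : Plane)‖ = t := by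
        rw [norm_smul, norm_eq_of_mem_sphere, mul_one, Real.norm_of_nonneg ht.1.le]
      simp only [Set.mem_ofPred_eq, hn]
      refine ⟨ht, z, hz, ?_⟩
      rw [smul_smul, inv_mul_cancel₀ ht.1.ne', one_smul]
    · rintro ⟨h1, h2⟩
      refine ⟨‖x‖, h1, _, h2, ?_⟩
      simp only
      rw [smul_smul, mul_inv_cancel₀ h1.1.ne', one_smul]
  rw [hset]
  have hs' : MeasurableSet (Subtype.val '' s : Set Plane) :=
    (MeasurableEmbedding.subtype_coe Metric.isClosed_sphere.measurableSet).measurableSet_image.2 hs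
  refine MeasurableSet.inter ?_ ?_
  · exact (measurableSet_Ioo (a := (0 : ℝ)) (b := 1)).preimage measurable_norm
  · exact hs'.preimage (measurable_norm.inv.smul measurable_id)

/-- Arc length is the image of Lebesgue measure on an interval of angles. -/
lemma measurePreserving_circleParam :
    MeasurePreserving circleParam (volume.restrict (Set.Ioo (-Real.pi) Real.pi))
      circleMeasure := by
  refine ⟨measurable_circleParam, Measure.ext fun s hs => ?_⟩
  rw [Measure.map_apply measurable_circleParam hs, circleMeasure, Measure.toSphere_apply' _ hs]
  have hS := measurableSet_Ioo_smul hs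
  -- The radial factor `1/2` cancels the dimension factor `2` in `toSphere`.
  have hhalf : ∫⁻ r in Set.Ioo (0 : ℝ) 1, ENNReal.ofReal r = 2⁻¹ := by
    rw [← ofReal_integral_eq_lintegral_ofReal]
    · rw [← integral_Ioc_eq_integral_Ioo, ← intervalIntegral.integral_of_le zero_le_one,
        integral_id, show ((1 : ℝ) ^ 2 - 0 ^ 2) / 2 = 2⁻¹ by norm_num,
        ENNReal.ofReal_inv_of_pos (by norm_num)]
      simp
    · exact (continuous_id.integrableOn_Icc).mono_set Set.Ioo_subset_Icc_self
    · exact (ae_restrict_iff' measurableSet_Ioo).2 (.of_forall fun r hr => hr.1.le)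
  have hvol : volume (Set.Ioo (0 : ℝ) 1 • (Subtype.val '' s : Set Plane)) =
      2⁻¹ * volume.restrict (Set.Ioo (-Real.pi) Real.pi) (circleParam ⁻¹' s) := by
    rw [← lintegral_indicator_one hS, lintegral_plane_polar (measurable_one.indicator hS),
      ← lintegral_indicator_one (measurable_circleParam hs), ← lintegral_const_mul _
        (measurable_one.indicator (measurable_circleParam hs))]
    refine lintegral_congr fun θ => ?_
    have : ∀ r ∈ Set.Ioi (0 : ℝ), ENNReal.ofReal r *
        (Set.Ioo (0 : ℝ) 1 • (Subtype.val '' s : Set Plane)).indicator (1 : Plane → ℝ≥0∞)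
          (r • (circleParam θ : Plane)) = (Set.Ioo (0 : ℝ) 1).indicator
          (fun r => ENNReal.ofReal r * (circleParam ⁻¹' s).indicator (1 : ℝ → ℝ≥0∞) θ) r := by
      intro r hr
      by_cases h1 : r < 1
      · rw [Set.indicator_of_mem (show r ∈ Set.Ioo (0 : ℝ) 1 from ⟨hr, h1⟩)]
        congr 1
        by_cases h2 : circleParam θ ∈ s
        · rw [Set.indicator_of_mem ((smul_circleParam_mem_iff hr).2 ⟨h1, h2⟩),
            Set.indicator_of_mem (by exact h2)]
          rfl
        · rw [Set.indicator_of_notMem (fun hc => h2 ((smul_circleParam_mem_iff hr).1 hc).2),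
            Set.indicator_of_notMem (by exact h2)]
      · rw [Set.indicator_of_notMem (fun hc => h1 ((smul_circleParam_mem_iff hr).1 hc).1),
          Set.indicator_of_notMem (fun hc => h1 hc.2), mul_zero]
    rw [setLIntegral_congr_fun measurableSet_Ioi this, lintegral_indicator measurableSet_Ioo,
      Measure.restrict_restrict measurableSet_Ioo,
      Set.inter_eq_left.2 (fun r hr => hr.1), lintegral_mul_const _ ENNReal.measurable_ofReal,
      hhalf]
  rw [hvol, ← mul_assoc]
  simp [ENNReal.mul_inv_cancel]

lemma restrict_Ioo_pi_eq_Ioc :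
    (volume : Measure ℝ).restrict (Set.Ioo (-Real.pi) Real.pi) =
      volume.restrict (Set.Ioc (-Real.pi) Real.pi) :=
  Measure.restrict_congr_set Ioo_ae_eq_Ioc

lemma circleFourier_eq_extension {f : Circle1 → ℂ} (hf : AEStronglyMeasurable f circleMeasure)
    (ξ : Plane) :
    circleFourier f ξ = extension (volume.restrict (Set.Ioc (-Real.pi) Real.pi))
      (fun θ => (circleParam θ : Plane)) (f ∘ circleParam) ξ := by
  have hm := measurePreserving_circleParam
  rw [restrict_Ioo_pi_eq_Ioc] at hm
  rw [circleFourier, ← hm.map_eq, integral_map hm.measurable.aemeasurable]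
  · rfl
  · rw [hm.map_eq]
    exact (measurable_kernel_comp measurable_const
      measurable_subtype_coe).aestronglyMeasurable.mul hf

/-! ### Finiteness for the circle: short arcs as convex graphs. -/

/-- The rotation carrying the lower half circle to the half circle around the angle `α`. -/
noncomputable def arcRotation (α : ℝ) : Plane ≃ₗᵢ[ℝ] Plane :=
  LinearIsometry.toLinearIsometryEquiv
    { toFun := fun p => !₂[-Real.sin α * p 0 - Real.cos α * p 1,
        Real.cos α * p 0 - Real.sin α * p 1]
      map_add' := fun p q => by
        ext i
        fin_cases i <;> simp <;> ring
      map_smul' := fun c p => by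
        ext i
        fin_cases i <;> simp <;> ring
      norm_map' := fun p => by
        have h := Real.sin_sq_add_cos_sq α
        simp only [EuclideanSpace.norm_eq, Fin.sum_univ_two, LinearMap.coe_mk, AddHom.coe_mk,
          Real.norm_eq_abs, sq_abs]
        congr 1
        simp
        linear_combination (p 0 ^ 2 + p 1 ^ 2) * h } rfl

lemma arcRotation_apply (α : ℝ) (p : Plane) :
    arcRotation α p = !₂[-Real.sin α * p 0 - Real.cos α * p 1,
        Real.cos α * p 0 - Real.sin α * p 1] := rfl

/-- The lower half circle as a graph. -/
noncomputable def lowerArc (x : ℝ) : ℝ := -√(1 - x ^ 2)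

lemma measurable_lowerArc : Measurable lowerArc := by
  unfold lowerArc
  fun_prop

lemma hasDerivAt_lowerArc {x : ℝ} (hx : x ∈ Set.Ioo (-1 : ℝ) 1) :
    HasDerivAt lowerArc (x / √(1 - x ^ 2)) x := by
  have h0 : 0 < 1 - x ^ 2 := by nlinarith [hx.1, hx.2]
  have h1 : HasDerivAt (fun x : ℝ => 1 - x ^ 2) (-(2 * x)) x := by
    simpa using (hasDerivAt_pow 2 x).const_sub 1
  have h2 := (h1.sqrt h0.ne').neg
  have e : x / √(1 - x ^ 2) = -(-(2 * x) / (2 * √(1 - x ^ 2))) := by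
    have := (Real.sqrt_pos.2 h0).ne'
    field_simp
  rw [e]
  exact h2

/-- Replacing `√(1 - y²)` by the smaller `√(1 - x²)` only lowers the right side, leaving `(x -
y)/√(1 - x²)`, whose denominator is at most 1. -/
lemma sub_le_lowerArc_slope_of_nonneg {x y : ℝ} (hx : x < 1) (hy : 0 ≤ y) (hxy : y ≤ x) :
    x - y ≤ x / √(1 - x ^ 2) - y / √(1 - y ^ 2) := by
  have hx0 : 0 < √(1 - x ^ 2) := Real.sqrt_pos.2 (by nlinarith)
  have hle : √(1 - x ^ 2) ≤ √(1 - y ^ 2) := Real.sqrt_le_sqrt (by nlinarith)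
  have h1 : √(1 - y ^ 2) ≤ 1 := Real.sqrt_le_one.2 (by nlinarith)
  have hy0 : 0 < √(1 - y ^ 2) := hx0.trans_le hle
  have h2 : y / √(1 - y ^ 2) ≤ y / √(1 - x ^ 2) := by gcongr
  have h3 : x - y ≤ (x - y) / √(1 - x ^ 2) := by
    rw [le_div_iff₀ hx0]
    nlinarith
  rw [sub_div] at h3
  linarith

/-- The slope is odd, so negative pairs reflect to positive ones; a pair straddling `0` is split at
`0`. -/
lemma sub_le_lowerArc_slope {x y : ℝ} (hx : x ∈ Set.Ioo (-1 : ℝ) 1)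
    (hy : y ∈ Set.Ioo (-1 : ℝ) 1) (hxy : y ≤ x) :
    x - y ≤ x / √(1 - x ^ 2) - y / √(1 - y ^ 2) := by
  rcases le_total 0 y with h0 | h0
  · exact sub_le_lowerArc_slope_of_nonneg hx.2 h0 hxy
  · have hy' := sub_le_lowerArc_slope_of_nonneg (x := -y) (y := 0) (by linarith [hy.1]) le_rfl
      (by linarith)
    rcases le_total 0 x with h1 | h1
    · have hx' := sub_le_lowerArc_slope_of_nonneg (x := x) (y := 0) hx.2 le_rfl h1
      simp only [neg_sq, neg_div, zero_div] at hx' hy'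
      linarith
    · have h := sub_le_lowerArc_slope_of_nonneg (x := -y) (y := -x) (by linarith [hy.1])
        (by linarith) (by linarith)
      simp only [neg_sq, neg_div] at h
      linarith

lemma half_le_cos {t : ℝ} (h : |t| ≤ Real.pi / 3) : 1 / 2 ≤ Real.cos t := by
  rw [← Real.cos_abs, ← Real.cos_pi_div_three]
  exact Real.cos_le_cos_of_nonneg_of_le_pi (abs_nonneg _) (by linarith [Real.pi_pos]) h

/-- An arc of half-angle `π / 3`, as a set of angles. -/
def arcAngles (α : ℝ) : Set ℝ := Set.Ioc (α - Real.pi / 3) (α + Real.pi / 3)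

lemma abs_sub_le_of_mem_arcAngles {α θ : ℝ} (h : θ ∈ arcAngles α) : |θ - α| ≤ Real.pi / 3 :=
  abs_le.2 ⟨by linarith [h.1], by linarith [h.2]⟩

lemma circleParam_eq_arcRotation {α θ : ℝ} (h : θ ∈ arcAngles α) :
    (circleParam θ : Plane) =
      arcRotation α !₂[Real.sin (θ - α), lowerArc (Real.sin (θ - α))] := by
  have hc := half_le_cos (abs_sub_le_of_mem_arcAngles h)
  have h1 : lowerArc (Real.sin (θ - α)) = -Real.cos (θ - α) := by
    rw [lowerArc, ← Real.cos_sq', Real.sqrt_sq (by linarith)]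
  rw [h1, arcRotation_apply]
  have e : θ = α + (θ - α) := by ring
  have ec := Real.cos_add α (θ - α)
  have es := Real.sin_add α (θ - α)
  rw [← e] at ec es
  ext i
  fin_cases i
  · simp [circleParam, ec]
    ring
  · simp [circleParam, es]
    ring

/-- Substituting `x = sin (θ - α)` has Jacobian `cos (θ - α)`, at least `1/2` on a half-angle of
`π/3`; hence the factor `2`. -/
lemma lintegral_arcAngles_le (α : ℝ) (H : ℝ → ℝ≥0∞) :
    ∫⁻ θ in arcAngles α, H (Real.sin (θ - α)) ≤ 2 * ∫⁻ x in Set.Ioo (-1 : ℝ) 1, H x := by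
  have hpi := Real.pi_pos
  have hI : MeasurableSet (arcAngles α) := measurableSet_Ioc
  have hder : ∀ θ ∈ arcAngles α, HasDerivWithinAt (fun θ => Real.sin (θ - α))
      (Real.cos (θ - α)) (arcAngles α) θ := fun θ _ => by
    simpa using (((hasDerivAt_id θ).sub_const α).sin).hasDerivWithinAt
  have hinj : Set.InjOn (fun θ => Real.sin (θ - α)) (arcAngles α) := by
    intro x hx y hy hxy
    have h1 := abs_le.1 (abs_sub_le_of_mem_arcAngles hx)
    have h2 := abs_le.1 (abs_sub_le_of_mem_arcAngles hy)
    have := Real.injOn_sin ⟨by linarith [h1.1], by linarith [h1.2]⟩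
      ⟨by linarith [h2.1], by linarith [h2.2]⟩ hxy
    linarith
  calc _ ≤ ∫⁻ θ in arcAngles α, 2 * (ENNReal.ofReal |Real.cos (θ - α)| *
        H (Real.sin (θ - α))) := by
        refine setLIntegral_mono' hI fun θ hθ => ?_
        have hc := half_le_cos (abs_sub_le_of_mem_arcAngles hθ)
        rw [← mul_assoc]
        refine le_mul_of_one_le_left (by positivity) ?_
        rw [← ENNReal.ofReal_ofNat 2, ← ENNReal.ofReal_mul (by norm_num), ENNReal.one_le_ofReal]
        have := le_abs_self (Real.cos (θ - α))
        linarith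
    _ = 2 * ∫⁻ x in (fun θ => Real.sin (θ - α)) '' arcAngles α, H x := by
        rw [lintegral_const_mul' _ _ (by simp),
          lintegral_image_eq_lintegral_abs_deriv_mul hI hder hinj]
    _ ≤ _ := by
        gcongr
        rintro _ ⟨θ, hθ, rfl⟩
        have hc := half_le_cos (abs_sub_le_of_mem_arcAngles hθ)
        have hcs := Real.sin_sq_add_cos_sq (θ - α)
        exact ⟨by nlinarith, by nlinarith⟩

/-- The threefold convolution of arc length on a short arc has bounded density. -/
lemma lintegral_arc_convolution_le (α : ℝ) {h : Plane → ℝ≥0∞} (hh : Measurable h) :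
    ∫⁻ x in arcAngles α, ∫⁻ y in arcAngles α, ∫⁻ z in arcAngles α,
      h ((circleParam x : Plane) + ((circleParam y : Plane) + (circleParam z : Plane))) ≤
      (8 * ENNReal.ofReal (2 * Real.pi / √3)) * ∫⁻ v, h v := by
  have hI : MeasurableSet (arcAngles α) := measurableSet_Ioc
  let R := arcRotation α
  let γ : ℝ → Plane := fun x => !₂[x, lowerArc x]
  have hγ : Measurable γ :=
    measurePreserving_toLp_pair.measurable.comp (measurable_id.prodMk measurable_lowerArc)
  let S : ℝ → ℝ := fun θ => Real.sin (θ - α)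
  have e : ∀ θ ∈ arcAngles α, (circleParam θ : Plane) = R (γ (S θ)) := fun θ hθ =>
    circleParam_eq_arcRotation hθ
  have hRm : Measurable R := R.continuous.measurable
  -- The graph bound is applied to `h ∘ R`: the rotation is linear, so it passes through the sum of
  -- three points, and it preserves area.
  have hconv := lintegral_graph_convolution_plane_le (measurableSet_Ioo (a := (-1 : ℝ)) (b := 1))
    (convex_Ioo _ _) measurable_lowerArc (fun x hx => hasDerivAt_lowerArc hx)
    (fun x hx y hy hxy => sub_le_lowerArc_slope hx hy hxy) (hh.comp hRm)
  have hR : ∫⁻ p, (h ∘ R) p = ∫⁻ p, h p := R.measurePreserving.lintegral_comp hh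
  rw [hR] at hconv
  calc _ = ∫⁻ x in arcAngles α, ∫⁻ y in arcAngles α, ∫⁻ z in arcAngles α,
        h (R (γ (S x) + (γ (S y) + γ (S z)))) := by
        refine setLIntegral_congr_fun hI fun x hx => setLIntegral_congr_fun hI fun y hy =>
          setLIntegral_congr_fun hI fun z hz => ?_
        simp only [e x hx, e y hy, e z hz, map_add]
    _ ≤ ∫⁻ x in arcAngles α, ∫⁻ y in arcAngles α, 2 * ∫⁻ z in Set.Ioo (-1 : ℝ) 1,
        h (R (γ (S x) + (γ (S y) + γ z))) := by
        gcongr with x y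
        exact lintegral_arcAngles_le α fun z => h (R (γ (S x) + (γ (S y) + γ z)))
    _ ≤ ∫⁻ x in arcAngles α, 2 * ∫⁻ y in Set.Ioo (-1 : ℝ) 1, 2 * ∫⁻ z in Set.Ioo (-1 : ℝ) 1,
        h (R (γ (S x) + (γ y + γ z))) := by
        gcongr with x
        exact lintegral_arcAngles_le α fun y => 2 * ∫⁻ z in Set.Ioo (-1 : ℝ) 1,
          h (R (γ (S x) + (γ y + γ z)))
    _ ≤ 2 * ∫⁻ x in Set.Ioo (-1 : ℝ) 1, 2 * ∫⁻ y in Set.Ioo (-1 : ℝ) 1,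
        2 * ∫⁻ z in Set.Ioo (-1 : ℝ) 1, h (R (γ x + (γ y + γ z))) :=
        lintegral_arcAngles_le α fun x => 2 * ∫⁻ y in Set.Ioo (-1 : ℝ) 1,
          2 * ∫⁻ z in Set.Ioo (-1 : ℝ) 1, h (R (γ x + (γ y + γ z)))
    -- `8 = 2³`, one Jacobian factor for each variable.
    _ = 8 * ∫⁻ x in Set.Ioo (-1 : ℝ) 1, ∫⁻ y in Set.Ioo (-1 : ℝ) 1,
        ∫⁻ z in Set.Ioo (-1 : ℝ) 1, h (R (γ x + (γ y + γ z))) := by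
        simp only [lintegral_const_mul' (2 : ℝ≥0∞) _ (by simp)]
        rw [← mul_assoc, ← mul_assoc]
        norm_num
    _ ≤ _ := by
        rw [mul_assoc]
        gcongr
        exact hconv

/-- The constant in the extension estimate for a short arc. -/
noncomputable def arcBound : ℝ≥0∞ :=
  (ENNReal.ofReal (4 * Real.pi ^ 2) * (8 * ENNReal.ofReal (2 * Real.pi / √3))) ^ (1 / 6 : ℝ)

lemma arcBound_ne_top : arcBound ≠ ⊤ :=
  ENNReal.rpow_ne_top_of_nonneg (by norm_num) (ENNReal.mul_ne_top ENNReal.ofReal_ne_top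
    (ENNReal.mul_ne_top (by simp) ENNReal.ofReal_ne_top))

lemma eLpNorm_extension_arc_le (α : ℝ) {f : ℝ → ℂ} (hf : IntegrableOn f (arcAngles α)) :
    eLpNorm (extension (volume.restrict (arcAngles α)) (fun θ => (circleParam θ : Plane)) f) 6
      volume ≤ arcBound * eLpNorm f 2 (volume.restrict (arcAngles α)) :=
  eLpNorm_extension_le continuous_circleParam_coe.measurable
    (fun _ hh => lintegral_arc_convolution_le α hh) hf

lemma Ioc_pi_eq_union_arcAngles : Set.Ioc (-Real.pi) Real.pi =
    arcAngles (-(2 * Real.pi / 3)) ∪ (arcAngles 0 ∪ arcAngles (2 * Real.pi / 3)) := by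
  have := Real.pi_pos
  rw [arcAngles, arcAngles, arcAngles, Set.union_comm (Set.Ioc (0 - Real.pi / 3) _)]
  ext x
  simp only [Set.mem_Ioc, Set.mem_union]
  constructor
  · rintro ⟨h1, h2⟩
    rcases le_or_gt x (-(Real.pi / 3)) with h | h
    · exact Or.inl ⟨by linarith, by linarith⟩
    · rcases le_or_gt x (Real.pi / 3) with h' | h'
      · exact Or.inr (Or.inr ⟨by linarith, by linarith⟩)
      · exact Or.inr (Or.inl ⟨by linarith, by linarith⟩)
  · rintro (⟨h1, h2⟩ | ⟨h1, h2⟩ | ⟨h1, h2⟩) <;> exact ⟨by linarith, by linarith⟩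

/-- The Tomas–Stein inequality for the circle, with a non-sharp constant. -/
theorem eLpNorm_circleFourier_le {f : Circle1 → ℂ} (hf : MemLp f 2 circleMeasure) :
    eLpNorm (circleFourier f) 6 volume ≤ 3 * (arcBound * eLpNorm f 2 circleMeasure) := by
  have hm := measurePreserving_circleParam
  rw [restrict_Ioo_pi_eq_Ioc] at hm
  have hpi := Real.pi_pos
  set g := f ∘ circleParam with hg
  have hg2 : MemLp g 2 (volume.restrict (Set.Ioc (-Real.pi) Real.pi)) :=
    hf.comp_measurePreserving hm
  have hnorm : eLpNorm g 2 (volume.restrict (Set.Ioc (-Real.pi) Real.pi)) =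
      eLpNorm f 2 circleMeasure := eLpNorm_comp_measurePreserving hf.1 hm
  have hg1 : IntegrableOn g (Set.Ioc (-Real.pi) Real.pi) := hg2.integrable (by norm_num)
  have hU := Ioc_pi_eq_union_arcAngles
  set A := arcAngles (-(2 * Real.pi / 3)) with hA
  set B := arcAngles 0 with hB
  set D := arcAngles (2 * Real.pi / 3) with hD
  have hAs : A ⊆ Set.Ioc (-Real.pi) Real.pi := hU ▸ Set.subset_union_left
  have hBs : B ⊆ Set.Ioc (-Real.pi) Real.pi :=
    hU ▸ Set.subset_union_left.trans Set.subset_union_right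
  have hDs : D ⊆ Set.Ioc (-Real.pi) Real.pi :=
    hU ▸ Set.subset_union_right.trans Set.subset_union_right
  have hBm : MeasurableSet B := measurableSet_Ioc
  have hDm : MeasurableSet D := measurableSet_Ioc
  have hBD : Disjoint B D := by
    rw [Set.disjoint_left]
    rintro x ⟨-, h1⟩ ⟨h2, -⟩
    linarith
  have hABD : Disjoint A (B ∪ D) := by
    rw [Set.disjoint_left]
    rintro x ⟨-, h1⟩ (⟨h2, -⟩ | ⟨h2, -⟩) <;> linarith
  let e : Set ℝ → Plane → ℂ := fun I =>
    extension (volume.restrict I) (fun θ => (circleParam θ : Plane)) g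
  have hγ : Measurable fun θ => (circleParam θ : Plane) := continuous_circleParam_coe.measurable
  have hsplit : circleFourier f = e A + (e B + e D) := by
    ext ξ
    have hint := integrable_kernel_mul hγ hg1 ξ
    rw [circleFourier_eq_extension hf.1]
    simp only [e, extension, Pi.add_apply, ← hg]
    rw [hU] at hint ⊢
    have hint' : IntegrableOn (fun x => kernel ξ (circleParam x) * g x) (A ∪ (B ∪ D)) := hint
    rw [setIntegral_union hABD (hBm.union hDm) hint'.left_of_union hint'.right_of_union,
      setIntegral_union hBD hDm hint'.right_of_union.left_of_union
        hint'.right_of_union.right_of_union]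
  have hmeas : ∀ I ⊆ Set.Ioc (-Real.pi) Real.pi, AEStronglyMeasurable (e I) volume :=
    fun I hI => (continuous_extension hγ (hg1.mono_set hI)).aestronglyMeasurable
  have hpiece : ∀ α, arcAngles α ⊆ Set.Ioc (-Real.pi) Real.pi →
      eLpNorm (e (arcAngles α)) 6 volume ≤ arcBound * eLpNorm f 2 circleMeasure := by
    intro α hα
    refine (eLpNorm_extension_arc_le α (hg1.mono_set hα)).trans ?_
    rw [← hnorm]
    gcongr
  rw [hsplit]
  refine (eLpNorm_add_le (hmeas _ hAs) ((hmeas _ hBs).add (hmeas _ hDs)) (by norm_num)).trans ?_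
  refine (add_le_add le_rfl (eLpNorm_add_le (hmeas _ hBs) (hmeas _ hDs) (by norm_num))).trans ?_
  refine (add_le_add (hpiece _ hAs) (add_le_add (hpiece _ hBs) (hpiece _ hDs))).trans_eq ?_
  ring

theorem circleConst_lt_top : circleConst < ⊤ := by
  refine lt_of_le_of_lt (b := 3 * (arcBound * 1)) ?_ ?_
  · refine iSup_le fun f => iSup_le fun hf => iSup_le fun hf1 => ?_
    rw [← hf1]
    exact eLpNorm_circleFourier_le hf
  · exact ENNReal.mul_lt_top (by simp) (ENNReal.mul_lt_top arcBound_ne_top.lt_top (by simp))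

/-! ### The lower bound for the circle from constants. -/

lemma circleMeasure_univ : circleMeasure Set.univ = ENNReal.ofReal (2 * Real.pi) := by
  rw [← measurePreserving_circleParam.measure_preimage MeasurableSet.univ.nullMeasurableSet]
  rw [Set.preimage_univ, Measure.restrict_apply_univ, Real.volume_Ioo]
  ring_nf

/-- The amplitude of the normalized constant function on the circle. -/
noncomputable def constAmplitude : ℝ := (√(2 * Real.pi))⁻¹

lemma constAmplitude_pos : 0 < constAmplitude := by
  have := Real.pi_pos
  unfold constAmplitude
  positivity

lemma eLpNorm_constAmplitude :
    eLpNorm (fun _ : Circle1 => (constAmplitude : ℂ)) 2 circleMeasure = 1 := by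
  have hpi := Real.pi_pos
  have hne : circleMeasure ≠ 0 := by
    intro h
    have := circleMeasure_univ
    rw [h] at this
    simp at this
    linarith
  rw [eLpNorm_const _ (by norm_num) hne, circleMeasure_univ, ← ofReal_norm, Complex.norm_real,
    Real.norm_of_nonneg constAmplitude_pos.le,
    ENNReal.ofReal_rpow_of_pos (by positivity), ← ENNReal.ofReal_mul constAmplitude_pos.le]
  simp only [ENNReal.toReal_ofNat, ← Real.sqrt_eq_rpow, constAmplitude]
  rw [inv_mul_cancel₀ (by positivity)]
  simp

lemma integral_quadratic_circle (a b : ℝ) :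
    ∫ θ in (-Real.pi)..Real.pi, (1 - (a * Real.cos θ + b * Real.sin θ) ^ 2 / 2) =
      2 * Real.pi * (1 - (a ^ 2 + b ^ 2) / 4) := by
  have h : ∀ θ ∈ Set.uIcc (-Real.pi) Real.pi, HasDerivAt
      (fun θ => θ - (a ^ 2 * (θ + Real.sin θ * Real.cos θ) +
        b ^ 2 * (θ - Real.sin θ * Real.cos θ) + 2 * a * b * Real.sin θ ^ 2) / 4)
      (1 - (a * Real.cos θ + b * Real.sin θ) ^ 2 / 2) θ := fun θ _ => by
    have hs := Real.hasDerivAt_sin θ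
    have hc := Real.hasDerivAt_cos θ
    have hsc := hs.mul hc
    have hid := hasDerivAt_id θ
    have h1 := ((((hid.add hsc).const_mul (a ^ 2)).add ((hid.sub hsc).const_mul (b ^ 2))).add
      ((hs.pow 2).const_mul (2 * a * b))).div_const 4
    refine (hid.sub h1).congr_deriv ?_
    have := Real.sin_sq_add_cos_sq θ
    simp
    linear_combination (-(a ^ 2 + b ^ 2) / 4) * this
  rw [intervalIntegral.integral_eq_sub_of_hasDerivAt h
    (Continuous.intervalIntegrable (by fun_prop) _ _)]
  simp
  ring

/-- The modulus dominates the real part, and `cos t ≥ 1 - t²/2` is integrated over the circle. In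
effect this is `J₀(r) ≥ 1 - r²/4` for the Bessel function. -/
lemma le_norm_circleFourier_const (ξ : Plane) :
    √(2 * Real.pi) * (1 - ‖ξ‖ ^ 2 / 4) ≤
      ‖circleFourier (fun _ => (constAmplitude : ℂ)) ξ‖ := by
  have hpi := Real.pi_pos
  have hnorm : ‖ξ‖ ^ 2 = ξ 0 ^ 2 + ξ 1 ^ 2 := by
    rw [EuclideanSpace.norm_eq, Real.sq_sqrt (by positivity), Fin.sum_univ_two]
    simp
  let μ := (volume : Measure ℝ).restrict (Set.Ioc (-Real.pi) Real.pi)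
  have hγ : Measurable fun θ => (circleParam θ : Plane) := continuous_circleParam_coe.measurable
  have hint : Integrable (fun θ => kernel ξ (circleParam θ) * (constAmplitude : ℂ)) μ :=
    integrable_kernel_mul hγ (integrable_const _) ξ
  have hre : ∀ θ, constAmplitude * (1 - (ξ 0 * Real.cos θ + ξ 1 * Real.sin θ) ^ 2 / 2) ≤
      (kernel ξ (circleParam θ) * (constAmplitude : ℂ)).re := by
    intro θ
    have e : (inner ℝ ξ (circleParam θ : Plane) : ℝ) = ξ 0 * Real.cos θ + ξ 1 * Real.sin θ := by
      simp [circleParam, PiLp.inner_apply, Fin.sum_univ_two, mul_comm]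
    rw [Complex.re_mul_ofReal, mul_comm, kernel, Complex.exp_re, e]
    refine mul_le_mul_of_nonneg_right ?_ constAmplitude_pos.le
    set t := ξ 0 * Real.cos θ + ξ 1 * Real.sin θ
    have : (-I * (t : ℂ)).re = 0 ∧ (-I * (t : ℂ)).im = -t := by simp
    rw [this.1, this.2, Real.exp_zero, one_mul, Real.cos_neg]
    exact Real.one_sub_sq_div_two_le_cos
  rw [circleFourier_eq_extension aestronglyMeasurable_const]
  refine le_trans ?_ (Complex.re_le_norm _)
  change _ ≤ (∫ θ, kernel ξ (circleParam θ) * (constAmplitude : ℂ) ∂μ).re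
  have hcomm : (∫ θ, kernel ξ (circleParam θ) * (constAmplitude : ℂ) ∂μ).re =
      ∫ θ, (kernel ξ (circleParam θ) * (constAmplitude : ℂ)).re ∂μ :=
    (integral_re hint).symm
  rw [hcomm]
  calc _ = ∫ θ, constAmplitude * (1 - (ξ 0 * Real.cos θ + ξ 1 * Real.sin θ) ^ 2 / 2) ∂μ := by
        rw [integral_const_mul, ← intervalIntegral.integral_of_le (by linarith),
          integral_quadratic_circle, ← hnorm, constAmplitude, ← mul_assoc]
        congr 1
        rw [inv_mul_eq_div, Real.div_sqrt]
    _ ≤ _ := by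
        refine integral_mono ?_ hint.re hre
        have hc : Continuous fun θ : ℝ =>
            constAmplitude * (1 - (ξ 0 * Real.cos θ + ξ 1 * Real.sin θ) ^ 2 / 2) := by
          fun_prop
        exact hc.integrableOn_Ioc

/-- Substituting `u = 1 - r²/4` gives `2 ∫₀¹ u⁶ du = 2/7`. The radius `2` is where the minorant
vanishes. -/
lemma lintegral_radial_profile :
    ∫⁻ r in Set.Ioo (0 : ℝ) 2, ENNReal.ofReal r *
      ENNReal.ofReal (√(2 * Real.pi) * (1 - r ^ 2 / 4)) ^ 6 =
      ENNReal.ofReal ((2 * Real.pi) ^ 3 * (2 / 7)) := by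
  have hpi := Real.pi_pos
  have hs : √(2 * Real.pi) ^ 6 = (2 * Real.pi) ^ 3 := by
    rw [show 6 = 2 * 3 by norm_num, pow_mul, Real.sq_sqrt (by positivity)]
  have hc : Continuous fun r : ℝ => r * (√(2 * Real.pi) * (1 - r ^ 2 / 4)) ^ 6 := by fun_prop
  have h1 : ∫⁻ r in Set.Ioo (0 : ℝ) 2, ENNReal.ofReal r *
      ENNReal.ofReal (√(2 * Real.pi) * (1 - r ^ 2 / 4)) ^ 6 =
      ∫⁻ r in Set.Ioo (0 : ℝ) 2,
        ENNReal.ofReal (r * (√(2 * Real.pi) * (1 - r ^ 2 / 4)) ^ 6) := by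
    refine setLIntegral_congr_fun measurableSet_Ioo fun r hr => ?_
    have : 0 ≤ √(2 * Real.pi) * (1 - r ^ 2 / 4) :=
      mul_nonneg (Real.sqrt_nonneg _) (by nlinarith [hr.1, hr.2])
    rw [ENNReal.ofReal_mul hr.1.le, ENNReal.ofReal_pow this]
  rw [h1, ← ofReal_integral_eq_lintegral_ofReal]
  · congr 1
    have hd : ∀ r ∈ Set.uIcc (0 : ℝ) 2, HasDerivAt
        (fun r => -(√(2 * Real.pi) ^ 6 * (2 / 7)) * (1 - r ^ 2 / 4) ^ 7)
        (r * (√(2 * Real.pi) * (1 - r ^ 2 / 4)) ^ 6) r := fun r _ => by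
      have h2 : HasDerivAt (fun r : ℝ => 1 - r ^ 2 / 4) (-(2 * r / 4)) r := by
        simpa using ((hasDerivAt_pow 2 r).div_const 4).const_sub 1
      refine ((h2.pow 7).const_mul _).congr_deriv ?_
      push_cast
      ring
    rw [← integral_Ioc_eq_integral_Ioo, ← intervalIntegral.integral_of_le (by norm_num),
      intervalIntegral.integral_eq_sub_of_hasDerivAt hd (hc.intervalIntegrable _ _), hs]
    norm_num
  · exact hc.integrableOn_Icc.mono_set Set.Ioo_subset_Icc_self
  · exact (ae_restrict_iff' measurableSet_Ioo).2 (.of_forall fun r hr => by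
      have := hr.1.le
      positivity)

/-- The radial integral is multiplied by the angle `2π`. Outside the disc of radius `2` the minorant
is negative and `ENNReal.ofReal` sends it to `0`, so its even power does no harm. -/
lemma le_lintegral_circleFourier_const :
    ENNReal.ofReal ((2 * Real.pi) ^ 4 * (2 / 7)) ≤
      ∫⁻ ξ, ‖circleFourier (fun _ => (constAmplitude : ℂ)) ξ‖ₑ ^ 6 := by
  have hpi := Real.pi_pos
  have hcont : Continuous fun ξ : Plane => √(2 * Real.pi) * (1 - ‖ξ‖ ^ 2 / 4) := by fun_prop
  calc _ = ∫⁻ θ in Set.Ioo (-Real.pi) Real.pi, ENNReal.ofReal ((2 * Real.pi) ^ 3 * (2 / 7)) := by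
        rw [setLIntegral_const, Real.volume_Ioo, ← ENNReal.ofReal_mul (by positivity)]
        congr 1
        ring
    _ ≤ ∫⁻ θ in Set.Ioo (-Real.pi) Real.pi, ∫⁻ r in Set.Ioi (0 : ℝ), ENNReal.ofReal r *
          ENNReal.ofReal (√(2 * Real.pi) * (1 - ‖r • (circleParam θ : Plane)‖ ^ 2 / 4)) ^ 6 := by
        refine lintegral_mono fun θ => ?_
        simp only
        rw [← lintegral_radial_profile]
        refine le_trans (le_of_eq ?_) (lintegral_mono_set
          (Set.Ioo_subset_Ioi_self (a := (2 : ℝ)) (b := 0)))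
        refine setLIntegral_congr_fun measurableSet_Ioo fun r hr => ?_
        rw [norm_smul, norm_eq_of_mem_sphere, mul_one, Real.norm_of_nonneg hr.1.le]
    _ = ∫⁻ ξ : Plane, ENNReal.ofReal (√(2 * Real.pi) * (1 - ‖ξ‖ ^ 2 / 4)) ^ 6 :=
        (lintegral_plane_polar (hcont.measurable.ennreal_ofReal.pow_const 6)).symm
    _ ≤ _ := by
        refine lintegral_mono fun ξ => ?_
        simp only
        rw [← ofReal_norm (circleFourier _ ξ)]
        gcongr
        exact le_norm_circleFourier_const ξ

theorem le_circleConst :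
    ENNReal.ofReal ((2 * Real.pi) ^ 4 * (2 / 7)) ^ (1 / 6 : ℝ) ≤ circleConst := by
  have hmem : MemLp (fun _ : Circle1 => (constAmplitude : ℂ)) 2 circleMeasure :=
    ⟨aestronglyMeasurable_const, by rw [eLpNorm_constAmplitude]; simp⟩
  refine le_trans ?_ (le_iSup_of_le _ (le_iSup_of_le hmem
    (le_iSup_of_le eLpNorm_constAmplitude le_rfl)))
  rw [eLpNorm_eq_lintegral_rpow_enorm_toReal (by simp) (by simp)]
  simp only [ENNReal.toReal_ofNat]
  refine ENNReal.rpow_le_rpow ?_ (by norm_num)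
  refine le_lintegral_circleFourier_const.trans_eq (lintegral_congr fun ξ => ?_)
  exact_mod_cast (ENNReal.rpow_natCast _ 6).symm

/-! ### Numerical comparison of the two bounds. -/

/-- After sixth powers the claim is `20π³/√3 < 32π⁴/7`. There is enough room for the crude bounds
`√3 > 1.7` and `π > 3`. -/
theorem rpow_mul_parabolaBound_lt :
    ((5 : ℝ≥0∞) / 2) ^ ((1 : ℝ) / 6) * parabolaBound <
      ENNReal.ofReal ((2 * Real.pi) ^ 4 * (2 / 7)) ^ (1 / 6 : ℝ) := by
  have hpi := Real.pi_gt_three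
  have h52 : (5 : ℝ≥0∞) / 2 = ENNReal.ofReal (5 / 2) := by
    rw [ENNReal.ofReal_div_of_pos (by norm_num)]
    simp
  rw [parabolaBound, ← ENNReal.mul_rpow_of_nonneg _ _ (by norm_num), h52,
    ← ENNReal.ofReal_mul (by positivity), ← ENNReal.ofReal_mul (by positivity)]
  refine ENNReal.rpow_lt_rpow ?_ (by norm_num)
  rw [ENNReal.ofReal_lt_ofReal_iff (by positivity)]
  have h3 : (1.7 : ℝ) < √3 := Real.lt_sqrt_of_sq_lt (by norm_num)
  have h4 : 2 * Real.pi / √3 < 2 * Real.pi / 1.7 := by gcongr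
  calc _ < 5 / 2 * (4 * Real.pi ^ 2 * (2 * Real.pi / 1.7)) := by gcongr
    _ = Real.pi ^ 3 * (20 / 1.7) := by ring
    _ < Real.pi ^ 3 * (32 / 7 * Real.pi) := by
        gcongr
        linarith
    _ = _ := by ring

end TomasStein

theorem proposition2p1 :
    TomasStein.circleConst < (⊤ : ENNReal) ∧
      ((5 : ENNReal) / 2) ^ ((1 : ℝ) / 6) * TomasStein.parabolaConst < TomasStein.circleConst := by
  refine ⟨TomasStein.circleConst_lt_top, ?_⟩
  calc _ ≤ ((5 : ENNReal) / 2) ^ ((1 : ℝ) / 6) * TomasStein.parabolaBound := by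
        gcongr
        exact TomasStein.parabolaConst_le
    _ < _ := TomasStein.rpow_mul_parabolaBound_lt
    _ ≤ _ := TomasStein.le_circleConst
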